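/- Let $\mathfrak n$ be a finite-dimensional real non-commutative two-step nilpotent Lie algebra with centre $\mathfrak z$, and let $N=\exp\mathfrak n$ be the corresponding connected, simply connected Lie group. Assume that $\mathfrak n=\mathfrak z\oplus\mathfrak m_1\oplus\mathfrak m$, where $\mathfrak p=\mathfrak z\oplus\mathfrak m_1$ and $\mathfrak m$ are commutative and $\dim\mathfrak m=\dim\mathfrak m_1=d$ (so $N=P\rtimes M$ with $P=\exp\mathfrak p$, $M=\exp\mathfrak m$ and $\dim P/Z=\dim M$, $Z=\exp\mathfrak z$ being the centre of $N$), and that $N$ is square-integrable modulo its centre, i.e. there is $\ell\in\mathfrak n^*$ with $\{a\in\mathfrak n:\ell[a,b]=0\ \forall b\in\mathfrak n\}=\mathfrak z$. Fix bases $Z_1,\dots,Z_k$ of $\mathfrak z$, $Y_1,\dots,Y_d$ of $\mathfrak m_1$, $X_1,\dots,X_d$ of $\mathfrak m$, identify $\mathfrak z^*$ with $\mathbb R^k$ by means of the basis dual to $(Z_l)$, and write the elements of $N$ as $n=\exp(\sum z_lZ_l)\exp(\sum y_jY_j)\exp(\sum x_iX_i)$, with Haar measure $dn=dz\,dy\,dx$.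 For $\lambda\in\mathfrak z^*$ let $B(\lambda)=-(\lambda[X_i,Y_j])_{i,j}$, let $\Sigma=\{\lambda\in\mathfrak z^*:\det B(\lambda)\neq0\}$, let $d\mu(\lambda)=|\det B(\lambda)|\,d\lambda$, and let $\pi_\lambda$ be the unitary representation of $N$ on $L^2(\mathbb R^d)$ given by $$\pi_\lambda(n)F(s)=e^{2\pi i(\langle\lambda,z\rangle+\langle s,B(\lambda)y\rangle)}F(s-x).$$ The Plancherel transform $\mathcal P:L^2(N)\to\int_\Sigma^\oplus L^2(\mathbb R^d)\otimes L^2(\mathbb R^d)\,d\mu(\lambda)$ is the continuous extension to $L^2(N)$ of the Fourier transform $f\mapsto\big(\int_N f(n)\pi_\lambda(n)\,dn\big)_{\lambda}$, $f\in L^1(N)\cap L^2(N)$, where the fibre $L^2(\mathbb R^d)\otimes L^2(\mathbb R^d)$ is the space of Hilbert-Schmidt operators on $L^2(\mathbb R^d)$ and $w\otimes u$ is the operator $h\mapsto\langle h,u\rangle w$. Let $L(g)f(n)=f(g^{-1}n)$ be the left regular representation of $N$ on $L^2(N)$. A closed subspace $\mathcal H\subset L^2(N)$ is called band-limited if there is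 a bounded measurable set $\mathbf I\subset\Sigma$ such that $\mathcal Pf$ vanishes almost everywhere outside $\mathbf I$ for every $f\in\mathcal H$. It is called multiplicity-free if there are a measurable set $S\subset\Sigma$ and a measurable field $(u(\lambda))_{\lambda\in S}$ of unit vectors of $L^2(\mathbb R^d)$ with $$\mathcal H=\mathcal P^{-1}\Big(\int_S^\oplus L^2(\mathbb R^d)\otimes u(\lambda)\,d\mu(\lambda)\Big).$$ A set $\Gamma\subset N$ is called a quasi-lattice if it is countable and there is a relatively compact Borel set $C\subset N$ such that $\Gamma C=N$ and $\gamma C\cap\gamma'C$ is a null set for all distinct $\gamma,\gamma'\in\Gamma$. **Theorem.** For every closed, left-invariant, band-limited, multiplicity-free subspace $\mathcal H$ of $L^2(N)$ there are a quasi-lattice $\Gamma\subset N$ and a function $f\in\mathcal H$ such that $\{L(\gamma)f:\gamma\in\Gamma\}$ is a Parseval frame for $\mathcal H$, i.e. $L(\gamma)f\in\mathcal H$ for all $\gamma\in\Gamma$ and $\sum_{\gamma\in\Gamma}|\langle\psi,L(\gamma)f\rangle|^2=\|\psi\|^2$ for all $\psi\in\mathcal H$. -/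

import Mathlib

open MeasureTheory Filter Topology Module
open scoped ComplexConjugate

noncomputable section

namespace TwoStep

variable {𝔫 : Type*} [LieRing 𝔫] [LieAlgebra ℝ 𝔫] {k d : ℕ}

/-! ### The Lie algebra and its basis `Z₁,…,Z_k, Y₁,…,Y_d, X₁,…,X_d` -/

/-- Index type of a basis `Z₁,…,Z_k, Y₁,…,Y_d, X₁,…,X_d`. -/
abbrev Idx (k d : ℕ) : Type := Fin k ⊕ (Fin d ⊕ Fin d)

/-- The basis vectors `Z_l`. -/
def Zb (v : Basis (Idx k d) ℝ 𝔫) (l : Fin k) : 𝔫 := v (Sum.inl l)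

/-- The basis vectors `Y_j`. -/
def Yb (v : Basis (Idx k d) ℝ 𝔫) (j : Fin d) : 𝔫 := v (Sum.inr (Sum.inl j))

/-- The basis vectors `X_i`. -/
def Xb (v : Basis (Idx k d) ℝ 𝔫) (i : Fin d) : 𝔫 := v (Sum.inr (Sum.inr i))

/-- The vector `z₁ Z₁ + ⋯ + z_k Z_k`. -/
def zVec (v : Basis (Idx k d) ℝ 𝔫) (z : Fin k → ℝ) : 𝔫 := ∑ l, z l • Zb v l

/-- The vector `y₁ Y₁ + ⋯ + y_d Y_d`. -/
def yVec (v : Basis (Idx k d) ℝ 𝔫) (y : Fin d → ℝ) : 𝔫 := ∑ j, y j • Yb v j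

/-- The vector `x₁ X₁ + ⋯ + x_d X_d`. -/
def xVec (v : Basis (Idx k d) ℝ 𝔫) (x : Fin d → ℝ) : 𝔫 := ∑ i, x i • Xb v i

/-- The class of Lie algebras: `𝔫` is non-commutative and two-step nilpotent, `𝔫 = 𝔷 ⊕ 𝔪₁ ⊕ 𝔪`
with `𝔷 = span Z` the centre, `𝔭 = 𝔷 ⊕ 𝔪₁` (`𝔪₁ = span Y`) and `𝔪 = span X` commutative,
`dim 𝔪 = dim 𝔭/𝔷 = d`, and the group is square-integrable modulo its centre:
the radical `𝔫(ℓ) = {a : ℓ[a, b] = 0 for all b}` of some functional `ℓ` is the centre. -/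
structure IsAdapted (v : Basis (Idx k d) ℝ 𝔫) : Prop where
  center_eq : (LieAlgebra.center ℝ 𝔫).toSubmodule = Submodule.span ℝ (Set.range (Zb v))
  lie_Y_Y : ∀ i j, ⁅Yb v i, Yb v j⁆ = 0
  lie_X_X : ∀ i j, ⁅Xb v i, Xb v j⁆ = 0
  two_step : ∀ a b : 𝔫, ⁅a, b⁆ ∈ LieAlgebra.center ℝ 𝔫
  nonabelian : ¬ IsLieAbelian 𝔫
  sq_integrable : ∃ ℓ : Dual ℝ 𝔫, ∀ a : 𝔫, (∀ b : 𝔫, ℓ ⁅a, b⁆ = 0) → a ∈ LieAlgebra.center ℝ 𝔫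

/-! ### The connected, simply connected group `N = exp 𝔫` -/

/-- The `Z`-coordinates of the bracket `[x₁ X₁ + ⋯ + x_d X_d, y₁ Y₁ + ⋯ + y_d Y_d]`. -/
def lieXY (v : Basis (Idx k d) ℝ 𝔫) (x y : Fin d → ℝ) : Fin k → ℝ :=
  fun l => v.repr ⁅xVec v x, yVec v y⁆ (Sum.inl l)

/-- The group `N = exp 𝔫` in the coordinates
`(z, y, x) ↔ exp (∑ z_l Z_l) exp (∑ y_j Y_j) exp (∑ x_i X_i)`. -/
def Grp (_v : Basis (Idx k d) ℝ 𝔫) : Type := (Fin k → ℝ) × (Fin d → ℝ) × (Fin d → ℝ)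

variable (v : Basis (Idx k d) ℝ 𝔫)

instance : TopologicalSpace (Grp v) :=
  inferInstanceAs (TopologicalSpace ((Fin k → ℝ) × (Fin d → ℝ) × (Fin d → ℝ)))

/-- The Haar measure of `N` is the Lebesgue measure in the coordinates `(z, y, x)`. -/
instance : MeasureSpace (Grp v) :=
  inferInstanceAs (MeasureSpace ((Fin k → ℝ) × (Fin d → ℝ) × (Fin d → ℝ)))

instance : BorelSpace (Grp v) :=
  inferInstanceAs (BorelSpace ((Fin k → ℝ) × (Fin d → ℝ) × (Fin d → ℝ)))

theorem lieXY_add_left (x x' y : Fin d → ℝ) :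
    lieXY v (x + x') y = lieXY v x y + lieXY v x' y := by
  funext l
  simp [lieXY, xVec, add_smul, Finset.sum_add_distrib]

theorem lieXY_add_right (x y y' : Fin d → ℝ) :
    lieXY v x (y + y') = lieXY v x y + lieXY v x y' := by
  funext l
  simp [lieXY, yVec, add_smul, Finset.sum_add_distrib]

theorem lieXY_zero_left (y : Fin d → ℝ) : lieXY v 0 y = 0 := by
  funext l
  simp [lieXY, xVec]

theorem lieXY_zero_right (x : Fin d → ℝ) : lieXY v x 0 = 0 := by
  funext l
  simp [lieXY, yVec]

theorem lieXY_neg_left (x y : Fin d → ℝ) : lieXY v (-x) y = -lieXY v x y := by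
  funext l
  simp only [lieXY, xVec, Pi.neg_apply, neg_smul, Finset.sum_neg_distrib, neg_lie, map_neg,
    Finsupp.neg_apply]

/-- The group law: since `exp x exp y' = exp [x, y'] exp y' exp x`, one has
`(z, y, x) (z', y', x') = (z + z' + [x, y'], y + y', x + x')`. -/
instance : Group (Grp v) where
  mul g h := (g.1 + h.1 + lieXY v g.2.2 h.2.1, g.2.1 + h.2.1, g.2.2 + h.2.2)
  one := (0, 0, 0)
  inv g := (-g.1 + lieXY v g.2.2 g.2.1, -g.2.1, -g.2.2)
  mul_assoc a b c := by
    change ((_, _, _) : (Fin k → ℝ) × (Fin d → ℝ) × (Fin d → ℝ)) = (_, _, _)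
    refine Prod.ext ?_ (Prod.ext (add_assoc _ _ _) (add_assoc _ _ _))
    change a.1 + b.1 + lieXY v a.2.2 b.2.1 + c.1 + lieXY v (a.2.2 + b.2.2) c.2.1
      = a.1 + (b.1 + c.1 + lieXY v b.2.2 c.2.1) + lieXY v a.2.2 (b.2.1 + c.2.1)
    rw [lieXY_add_left, lieXY_add_right]
    abel
  one_mul a := by
    refine Prod.ext ?_ (Prod.ext (zero_add a.2.1) (zero_add a.2.2))
    change 0 + a.1 + lieXY v 0 a.2.1 = a.1
    rw [lieXY_zero_left]
    abel
  mul_one a := by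
    refine Prod.ext ?_ (Prod.ext (add_zero a.2.1) (add_zero a.2.2))
    change a.1 + 0 + lieXY v a.2.2 0 = a.1
    rw [lieXY_zero_right]
    abel
  inv_mul_cancel a := by
    refine Prod.ext ?_ (Prod.ext (neg_add_cancel a.2.1) (neg_add_cancel a.2.2))
    change -a.1 + lieXY v a.2.2 a.2.1 + a.1 + lieXY v (-a.2.2) a.2.1 = 0
    rw [lieXY_neg_left]
    abel

/-- The Baker-Campbell-Hausdorff product of a two-step nilpotent Lie algebra:
`exp a exp b = exp (bch a b)`. -/
def bch (a b : 𝔫) : 𝔫 := a + b + (1 / 2 : ℝ) • ⁅a, b⁆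

/-- The logarithm `log : N → 𝔫` in the coordinates `(z, y, x)`. -/
def logMap (g : Grp v) : 𝔫 := bch (bch (zVec v g.1) (yVec v g.2.1)) (xVec v g.2.2)

theorem zVec_add (z z' : Fin k → ℝ) : zVec v (z + z') = zVec v z + zVec v z' := by
  simp [zVec, add_smul, Finset.sum_add_distrib]

theorem yVec_add (y y' : Fin d → ℝ) : yVec v (y + y') = yVec v y + yVec v y' := by
  simp [yVec, add_smul, Finset.sum_add_distrib]

theorem xVec_add (x x' : Fin d → ℝ) : xVec v (x + x') = xVec v x + xVec v x' := by
  simp [xVec, add_smul, Finset.sum_add_distrib]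

theorem vec_repr (a : 𝔫) : zVec v (fun l => v.repr a (Sum.inl l))
    + yVec v (fun j => v.repr a (Sum.inr (Sum.inl j)))
    + xVec v (fun i => v.repr a (Sum.inr (Sum.inr i))) = a := by
  conv_rhs => rw [← v.sum_repr a, Fintype.sum_sum_type, Fintype.sum_sum_type]
  simp only [zVec, yVec, xVec, Zb, Yb, Xb, add_assoc]

theorem repr_vec (z : Fin k → ℝ) (y x : Fin d → ℝ) :
    (fun l => v.repr (zVec v z + yVec v y + xVec v x) (Sum.inl l)) = z ∧
    (fun j => v.repr (zVec v z + yVec v y + xVec v x) (Sum.inr (Sum.inl j))) = y ∧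
    (fun i => v.repr (zVec v z + yVec v y + xVec v x) (Sum.inr (Sum.inr i))) = x := by
  refine ⟨?_, ?_, ?_⟩ <;> funext i <;>
    simp [zVec, yVec, xVec, Zb, Yb, Xb, Finsupp.single_apply]

variable {v}

theorem IsAdapted.repr_center (hv : IsAdapted v) {a : 𝔫} (ha : a ∈ LieAlgebra.center ℝ 𝔫) :
    zVec v (fun l => v.repr a (Sum.inl l)) = a := by
  have ha' : a ∈ Submodule.span ℝ (Set.range (Zb v)) := hv.center_eq ▸ ha
  obtain ⟨c, rfl⟩ := (Submodule.mem_span_range_iff_exists_fun ℝ).1 ha'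
  have := (repr_vec v c 0 0).1
  simp only [yVec, xVec, Pi.zero_apply, zero_smul, Finset.sum_const_zero, add_zero] at this
  change zVec v (fun l => v.repr (zVec v c) (Sum.inl l)) = zVec v c
  rw [this]

theorem IsAdapted.zVec_mem (hv : IsAdapted v) (z : Fin k → ℝ) :
    zVec v z ∈ LieAlgebra.center ℝ 𝔫 := by
  have : zVec v z ∈ (LieAlgebra.center ℝ 𝔫).toSubmodule := by
    rw [hv.center_eq]
    exact (Submodule.mem_span_range_iff_exists_fun ℝ).2 ⟨z, rfl⟩
  exact this

theorem lie_center_right {a : 𝔫} (ha : a ∈ LieAlgebra.center ℝ 𝔫) (b : 𝔫) : ⁅b, a⁆ = 0 :=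
  (LieModule.mem_maxTrivSubmodule ℝ 𝔫 𝔫 a).1 ha b

theorem lie_center_left {a : 𝔫} (ha : a ∈ LieAlgebra.center ℝ 𝔫) (b : 𝔫) : ⁅a, b⁆ = 0 := by
  rw [← lie_skew, lie_center_right ha, neg_zero]

theorem IsAdapted.logMap_eq (hv : IsAdapted v) (g : Grp v) :
    logMap v g = zVec v g.1 + yVec v g.2.1 + xVec v g.2.2
      - (1 / 2 : ℝ) • zVec v (lieXY v g.2.2 g.2.1) := by
  have h1 : zVec v (lieXY v g.2.2 g.2.1) = ⁅xVec v g.2.2, yVec v g.2.1⁆ :=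
    hv.repr_center (hv.two_step _ _)
  rw [h1, ← lie_skew]
  simp only [logMap, bch, lie_center_left (hv.zVec_mem _), smul_zero, add_zero, add_lie, zero_add,
    smul_neg, sub_neg_eq_add]

/-- `N` is `𝔫` with the Baker-Campbell-Hausdorff product: `log` is multiplicative. -/
theorem IsAdapted.logMap_mul (hv : IsAdapted v) (g h : Grp v) :
    logMap v (g * h) = bch (logMap v g) (logMap v h) := by
  have hY : ∀ y y' : Fin d → ℝ, ⁅yVec v y, yVec v y'⁆ = 0 := fun y y' => by
    simp [yVec, sum_lie, lie_sum, hv.lie_Y_Y]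
  have hX : ∀ x x' : Fin d → ℝ, ⁅xVec v x, xVec v x'⁆ = 0 := fun x x' => by
    simp [xVec, sum_lie, lie_sum, hv.lie_X_X]
  have hc : ∀ x y : Fin d → ℝ, zVec v (lieXY v x y) = ⁅xVec v x, yVec v y⁆ :=
    fun x y => hv.repr_center (hv.two_step _ _)
  rw [hv.logMap_eq, hv.logMap_eq, hv.logMap_eq]
  change zVec v (g.1 + h.1 + lieXY v g.2.2 h.2.1) + yVec v (g.2.1 + h.2.1)
    + xVec v (g.2.2 + h.2.2)
    - (1 / 2 : ℝ) • zVec v (lieXY v (g.2.2 + h.2.2) (g.2.1 + h.2.1)) = _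
  simp only [bch, add_lie, lie_add, sub_lie, lie_sub, smul_lie, lie_smul,
    lie_center_left (hv.zVec_mem _), lie_center_right (hv.zVec_mem _), hY, hX,
    lie_center_left (hv.two_step _ _), lie_center_right (hv.two_step _ _),
    zVec_add, yVec_add, xVec_add, lieXY_add_left, lieXY_add_right, hc]
  rw [← lie_skew (yVec v g.2.1) (xVec v h.2.2)]
  module

/-- `log` is a bijection of `N` onto `𝔫`. -/
theorem IsAdapted.logMap_bijective (hv : IsAdapted v) : Function.Bijective (logMap v) := by
  have key : ∀ (z : Fin k → ℝ) (y x : Fin d → ℝ), zVec v z + yVec v y + xVec v x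
      - (1 / 2 : ℝ) • zVec v (lieXY v x y)
      = zVec v (z - (1 / 2 : ℝ) • lieXY v x y) + yVec v y + xVec v x := fun z y x => by
    simp only [zVec, Finset.smul_sum, Pi.sub_apply, Pi.smul_apply, sub_smul, smul_eq_mul, mul_smul,
      Finset.sum_sub_distrib]
    abel
  constructor
  · intro g g' h
    rw [hv.logMap_eq, hv.logMap_eq, key, key] at h
    obtain ⟨z, y, x⟩ := g
    obtain ⟨z', y', x'⟩ := g'
    have h1 := repr_vec v (z - (1 / 2 : ℝ) • lieXY v x y) y x
    have h2 := repr_vec v (z' - (1 / 2 : ℝ) • lieXY v x' y') y' x'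
    simp only at h
    rw [h] at h1
    obtain rfl : y = y' := h1.2.1.symm.trans h2.2.1
    obtain rfl : x = x' := h1.2.2.symm.trans h2.2.2
    have h3 := h1.1.symm.trans h2.1
    simp only [sub_left_inj] at h3
    rw [h3]
  · intro a
    let y : Fin d → ℝ := fun j => v.repr a (Sum.inr (Sum.inl j))
    let x : Fin d → ℝ := fun i => v.repr a (Sum.inr (Sum.inr i))
    let z : Fin k → ℝ := fun l => v.repr a (Sum.inl l)
    let g : Grp v := (z + (1 / 2 : ℝ) • lieXY v x y, y, x)
    refine ⟨g, ?_⟩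
    rw [hv.logMap_eq, key]
    have hz : g.1 - (1 / 2 : ℝ) • lieXY v g.2.2 g.2.1 = z :=
      add_sub_cancel_right z ((1 / 2 : ℝ) • lieXY v x y)
    rw [hz]
    exact vec_repr v a

variable (v)

/-- Left translations of `N` preserve the measure. -/
theorem measurePreserving_mul_left (g : Grp v) :
    MeasurePreserving (fun n : Grp v => g * n) volume volume := by
  have hlin : Continuous fun y : Fin d → ℝ => lieXY v g.2.2 y := by
    have : (fun y : Fin d → ℝ => lieXY v g.2.2 y)
        = fun y l => ∑ j, y j * v.repr ⁅xVec v g.2.2, Yb v j⁆ (Sum.inl l) := by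
      funext y l
      simp only [lieXY, yVec, lie_sum, lie_smul, map_sum, map_smul, Finsupp.coe_finsetSum,
        Finset.sum_apply, Finsupp.smul_apply, smul_eq_mul]
    rw [this]
    fun_prop
  have h1 : MeasurePreserving
      (fun p : ((Fin d → ℝ) × (Fin d → ℝ)) × (Fin k → ℝ) =>
        ((g.2.1 + p.1.1, g.2.2 + p.1.2), g.1 + p.2 + lieXY v g.2.2 p.1.1))
      volume volume := by
    have hb : MeasurePreserving
        (fun p : (Fin d → ℝ) × (Fin d → ℝ) => (g.2.1 + p.1, g.2.2 + p.2)) volume volume :=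
      (measurePreserving_add_left volume g.2.1).prod (measurePreserving_add_left volume g.2.2)
    refine hb.skew_product (g := fun p z => g.1 + z + lieXY v g.2.2 p.1) ?_ ?_
    · exact Continuous.measurable
        ((continuous_const.add continuous_snd).add (hlin.comp (continuous_fst.comp continuous_fst)))
    · refine Filter.Eventually.of_forall fun p => ?_
      have := measurePreserving_add_left (volume : Measure (Fin k → ℝ)) (g.1 + lieXY v g.2.2 p.1)
      have h2 : (fun z : Fin k → ℝ => g.1 + z + lieXY v g.2.2 p.1)
          = fun z => g.1 + lieXY v g.2.2 p.1 + z := by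
        funext z
        abel
      rw [h2]
      exact this.map_eq
  have hs : MeasurePreserving
      (Prod.swap : (Fin k → ℝ) × ((Fin d → ℝ) × (Fin d → ℝ)) → _) volume volume :=
    Measure.measurePreserving_swap
  have hs' : MeasurePreserving
      (Prod.swap : ((Fin d → ℝ) × (Fin d → ℝ)) × (Fin k → ℝ) → _) volume volume :=
    Measure.measurePreserving_swap
  exact hs'.comp (h1.comp hs)

/-- The Hilbert space `L²(N)`. -/
abbrev L2N : Type := Lp ℂ 2 (volume : Measure (Grp v))

/-- The left regular representation `(L(g) f)(n) = f (g⁻¹ n)` on `L²(N)`. -/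
def leftReg (g : Grp v) : L2N v →ₗᵢ[ℂ] L2N v :=
  Lp.compMeasurePreservingₗᵢ ℂ (fun n : Grp v => g⁻¹ * n) (measurePreserving_mul_left v g⁻¹)

/-! ### The irreducible representations `π_λ` -/

/-- The Hilbert space `L²(ℝᵈ)`. -/
abbrev L2R (d : ℕ) : Type := Lp ℂ 2 (volume : Measure (Fin d → ℝ))

/-- The functional on `𝔫` with coordinates `λ` on the centre, vanishing on all `Y_j`, `X_i`. -/
def dualOf (lam : Fin k → ℝ) : Dual ℝ 𝔫 := ∑ l, lam l • v.coord (Sum.inl l)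

/-- The matrix `B(λ) = -(λ[X_i, Y_j])_{i,j}`. -/
def matB (lam : Fin k → ℝ) : Matrix (Fin d) (Fin d) ℝ :=
  Matrix.of fun i j => -dualOf v lam ⁅Xb v i, Yb v j⁆

/-- The set `Σ ⊂ 𝔷* = ℝᵏ` of those `λ` with `det B(λ) ≠ 0`. -/
def crossSection : Set (Fin k → ℝ) := {lam | (matB v lam).det ≠ 0}

/-- The Plancherel measure `dμ(λ) = |det B(λ)| dλ`. -/
def plancherelMeasure : Measure (Fin k → ℝ) :=
  volume.withDensity fun lam => ENNReal.ofReal |(matB v lam).det|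

instance : SFinite (plancherelMeasure v) := by
  unfold plancherelMeasure
  infer_instance

/-- The function `(π_λ(n) F)(s) = exp(2πi (⟨λ, z⟩ + ⟨s, B(λ) y⟩)) F(s - x)` for `n = (z, y, x)`. -/
def repFun (lam : Fin k → ℝ) (n : Grp v) (F : (Fin d → ℝ) → ℂ) (s : Fin d → ℝ) : ℂ :=
  Complex.exp (2 * Real.pi * Complex.I *
    ((lam ⬝ᵥ n.1 + s ⬝ᵥ (matB v lam).mulVec n.2.1 : ℝ) : ℂ)) * F (s - n.2.2)

theorem memLp_repFun (lam : Fin k → ℝ) (n : Grp v) (F : L2R d) :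
    MemLp (repFun v lam n F) 2 (volume : Measure (Fin d → ℝ)) := by
  have hF : MemLp (fun s : Fin d → ℝ => F (s - n.2.2)) 2 volume :=
    (Lp.memLp F).comp_measurePreserving (measurePreserving_sub_right volume n.2.2)
  refine hF.of_le (g := fun s => F (s - n.2.2)) (AEStronglyMeasurable.mul ?_ hF.1) ?_
  · refine Continuous.aestronglyMeasurable ?_
    unfold dotProduct
    fun_prop
  · refine Filter.Eventually.of_forall fun s => ?_
    have h : (2 * Real.pi * Complex.I *
        ((lam ⬝ᵥ n.1 + s ⬝ᵥ (matB v lam).mulVec n.2.1 : ℝ) : ℂ))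
        = ((2 * Real.pi * (lam ⬝ᵥ n.1 + s ⬝ᵥ (matB v lam).mulVec n.2.1) : ℝ) : ℂ)
          * Complex.I := by
      push_cast
      ring
    simp only [repFun, norm_mul]
    rw [h, Complex.norm_exp_ofReal_mul_I, one_mul]

/-- The operator `π_λ(n)` on `L²(ℝᵈ)`. -/
def rep (lam : Fin k → ℝ) (n : Grp v) (F : L2R d) : L2R d := (memLp_repFun v lam n F).toLp _

/-! ### The Plancherel transform -/

/-- The direct integral `∫_Σ^⊕ L²(ℝᵈ) ⊗ L²(ℝᵈ) dμ(λ)`, realised as `L²(Σ × ℝᵈ × ℝᵈ)`: the fibre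
`L²(ℝᵈ) ⊗ L²(ℝᵈ)` is the space of Hilbert-Schmidt operators on `L²(ℝᵈ)`, identified with their
integral kernels in `L²(ℝᵈ × ℝᵈ)`.
(`plancherelMeasure v` gives the complement of `Σ` measure zero.) -/
abbrev DirectInt : Type :=
  Lp ℂ 2 ((plancherelMeasure v).prod (volume : Measure ((Fin d → ℝ) × (Fin d → ℝ))))

/-- `f ∈ L¹(N) ∩ L²(N)`, and for almost every `λ` the operator `∫_N f(n) π_λ(n) dn` (as a weak
integral) is the Hilbert-Schmidt operator with kernel `K(λ, ·, ·)`. -/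
def IsFourierTransform (f : L2N v) (K : DirectInt v) : Prop :=
  Integrable f volume ∧
    ∀ᵐ lam ∂(plancherelMeasure v), ∀ w₁ w₂ : L2R d,
      ∫ n : Grp v, f n * inner ℂ w₂ (rep v lam n w₁)
        = ∫ p : (Fin d → ℝ) × (Fin d → ℝ), K (lam, p) * w₁ p.2 * conj (w₂ p.1)

/-- `K` is the Plancherel transform of `f`: the Plancherel transform is the continuous extension
to `L²(N)` of the Fourier transform on `L¹(N) ∩ L²(N)`, so its graph is the closure of the graph
of the latter. -/
def IsPlancherelTransform (f : L2N v) (K : DirectInt v) : Prop :=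
  (f, K) ∈ closure {p : L2N v × DirectInt v | IsFourierTransform v p.1 p.2}

/-! ### Subspaces of `L²(N)` -/

/-- `H` is invariant under the left regular representation. -/
def IsLeftInvariant (H : Submodule ℂ (L2N v)) : Prop :=
  ∀ g : Grp v, ∀ f ∈ H, leftReg v g f ∈ H

/-- `H` is band-limited: there is a bounded measurable set `I ⊆ Σ` on which the Plancherel
transforms of all elements of `H` are supported. -/
def IsBandlimited (H : Submodule ℂ (L2N v)) : Prop :=
  ∃ I : Set (Fin k → ℝ), MeasurableSet I ∧ Bornology.IsBounded I ∧ I ⊆ crossSection v ∧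
    ∀ f ∈ H, ∃ K : DirectInt v, IsPlancherelTransform v f K ∧
      ∀ᵐ lam ∂(plancherelMeasure v), lam ∉ I →
        (fun p : (Fin d → ℝ) × (Fin d → ℝ) => K (lam, p)) =ᵐ[volume] 0

/-- `K` lies in `∫_S^⊕ L²(ℝᵈ) ⊗ u(λ) dμ(λ)`: for almost every `λ ∈ S` it is of the form
`w ⊗ u(λ)` with `w ∈ L²(ℝᵈ)`, i.e. it is the kernel of the operator `h ↦ ⟨h, u(λ)⟩ w`, and it
vanishes for almost every `λ` outside `S`. -/
def MemFibered (S : Set (Fin k → ℝ)) (u : (Fin k → ℝ) → (Fin d → ℝ) → ℂ)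
    (K : DirectInt v) : Prop :=
  ∀ᵐ lam ∂(plancherelMeasure v),
    (lam ∈ S → ∃ w : L2R d, (fun p : (Fin d → ℝ) × (Fin d → ℝ) => K (lam, p))
      =ᵐ[volume] fun p => w p.1 * conj (u lam p.2)) ∧
    (lam ∉ S → (fun p : (Fin d → ℝ) × (Fin d → ℝ) => K (lam, p)) =ᵐ[volume] 0)

/-- `H` is multiplicity-free: `H = 𝒫⁻¹ (∫_S^⊕ L²(ℝᵈ) ⊗ u(λ) dμ(λ))` for a measurable `S ⊆ Σ` and a
measurable field `(u(λ))_{λ ∈ S}` of unit vectors of `L²(ℝᵈ)`. -/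
def IsMultiplicityFree (H : Submodule ℂ (L2N v)) : Prop :=
  ∃ (S : Set (Fin k → ℝ)) (u : (Fin k → ℝ) → (Fin d → ℝ) → ℂ),
    MeasurableSet S ∧ S ⊆ crossSection v ∧ Measurable (Function.uncurry u) ∧
    (∀ lam ∈ S, eLpNorm (u lam) 2 volume = 1) ∧
    ∀ f : L2N v, f ∈ H ↔ ∃ K : DirectInt v, IsPlancherelTransform v f K ∧ MemFibered v S u K

/-- `Γ` is a quasi-lattice of the group `G`: it is countable and there is a relatively compact
Borel set `C` with `Γ C = G` and `γ C ∩ γ' C` null for distinct `γ, γ' ∈ Γ`. -/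
def IsQuasiLattice {G : Type*} [Group G] [TopologicalSpace G] [MeasureSpace G]
    (Γ : Set G) : Prop :=
  Γ.Countable ∧ ∃ C : Set G, MeasurableSet C ∧ IsCompact (closure C) ∧
    (⋃ γ ∈ Γ, (fun n => γ * n) '' C) = Set.univ ∧
    ∀ γ ∈ Γ, ∀ γ' ∈ Γ, γ ≠ γ' →
      volume (((fun n => γ * n) '' C) ∩ ((fun n => γ' * n) '' C)) = 0

/-- The family `φ` is a Parseval frame for the subspace `H`. -/
def IsParsevalFrame {E ι : Type*} [NormedAddCommGroup E] [InnerProductSpace ℂ E]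
    (H : Submodule ℂ E) (φ : ι → E) : Prop :=
  (∀ i, φ i ∈ H) ∧ ∀ ψ ∈ H, HasSum (fun i => ‖inner ℂ (φ i) ψ‖ ^ 2) (‖ψ‖ ^ 2)

end TwoStep

end

noncomputable section

namespace TwoStep

/-! ### Functions on products that integrate to zero over rectangles -/

section Rectangles

variable {α β : Type*} [MeasurableSpace α] [MeasurableSpace β]

/-! For integrable `f`, the operator `∫ f(n) π_λ(n) dn` has the kernel `(λ, s, t) ↦ pft f (λ, s
B(λ), s - t)`, where `pft` is the Euclidean inverse Fourier transform in the coordinates `(z, y)`.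
The substitution `psi : (λ, s, t) ↦ (λ, s B(λ), s - t)` carries `μ × ds × dt` to Lebesgue measure,
because the density `|det B(λ)|` of `μ` is the Jacobian of `s ↦ s B(λ)`. Square integrability modulo
the centre makes `det B(λ) ≠ 0` almost everywhere. Hence the Plancherel transform is an ordinary
partial Fourier transform in disguise. It is the graph of a unitary operator (`exists_plancherel`),
and it turns left translation by `γ` into a shift in `s` times a unimodular phase
(`plancherel_leftReg`).

An element of the multiplicity-free space has a kernel `w(λ, s) conj u(λ, t)`. Pairing with `u(λ,
·)` identifies it isometrically with the scalar function `w` (`integrable_fiberCoeff`), supported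
over the bounded set `S ∩ I`. The frame generator has the kernel `c 1_{S ∩ I}(λ) 1_{[0,1)ᵈ}(s) conj
u(λ, t)`, and the quasi-lattice consists of the points `exp(x·X) exp(a m·Z) exp(a n·Y)` with
integral `x, m, n`. The `X`-part moves the box `[0,1)ᵈ` to `x + [0,1)ᵈ`, and these boxes tile `ℝᵈ`.
Within one box the remaining phase is the exponential with frequency `(a m, a n)` in the variable
`(λ, s B(λ))` (`phase_latticePoint`). By boundedness of `S ∩ I` this variable stays in a cube `(-R,
R)^{k+d}`. With `a = 1/(2R)`, Parseval's identity for Fourier series on that cube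
(`hasSum_scaledCube`) sums the coefficients over `(m, n)` to the mass of `w` on the box
(`hasSum_latticePoint`). Summing over `x` gives `‖ψ‖²`. The support need not fill the cube, which is
why the construction gives a Parseval frame and not in general an orthonormal basis. -/

theorem ae_eq_zero_of_setIntegral_prod_finite {μ : Measure α} {ν : Measure β} [IsFiniteMeasure μ]
    [IsFiniteMeasure ν] {h : α × β → ℂ} (hint : Integrable h (μ.prod ν))
    (h0 : ∀ A B, MeasurableSet A → MeasurableSet B → ∫ p in A ×ˢ B, h p ∂(μ.prod ν) = 0) :
    h =ᵐ[μ.prod ν] 0 := by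
  refine hint.ae_eq_zero_of_forall_setIntegral_eq_zero fun s hs _ => ?_
  have huniv : ∫ p, h p ∂(μ.prod ν) = 0 := by
    simpa using h0 Set.univ Set.univ MeasurableSet.univ MeasurableSet.univ
  -- Dynkin's argument: rectangles form a π-system generating the product σ-algebra, and `huniv`
  -- handles complements.
  refine MeasurableSpace.induction_on_inter (C := fun s _ => ∫ p in s, h p ∂(μ.prod ν) = 0)
    generateFrom_prod.symm isPiSystem_prod ?_ ?_ ?_ ?_ s hs
  · simp
  · rintro _ ⟨A, hA, B, hB, rfl⟩
    exact h0 A B hA hB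
  · intro t ht h1
    rw [← integral_add_compl ht hint, h1, zero_add] at huniv
    exact huniv
  · intro f hd hm h1
    rw [integral_iUnion hm hd hint.integrableOn]
    simp [h1]

/-- Exhaust by products of spanning sets and use the finite case on each. Integrability is asked
only on rectangles of finite measure, which is all that is known of Fourier kernels at a fixed `λ`.
-/
theorem ae_eq_zero_of_setIntegral_prod {μ : Measure α} {ν : Measure β} [SigmaFinite μ]
    [SigmaFinite ν] {h : α × β → ℂ}
    (hint : ∀ A B, MeasurableSet A → MeasurableSet B → μ A < ⊤ → ν B < ⊤ →
      IntegrableOn h (A ×ˢ B) (μ.prod ν))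
    (h0 : ∀ A B, MeasurableSet A → MeasurableSet B → μ A < ⊤ → ν B < ⊤ →
      ∫ p in A ×ˢ B, h p ∂(μ.prod ν) = 0) :
    h =ᵐ[μ.prod ν] 0 := by
  have key : ∀ n, ∀ᵐ p ∂(μ.prod ν), p ∈ spanningSets μ n ×ˢ spanningSets ν n → h p = 0 := by
    intro n
    have hmA := measurableSet_spanningSets μ n
    have hmB := measurableSet_spanningSets ν n
    rw [← ae_restrict_iff' (hmA.prod hmB), ← Measure.prod_restrict]
    have : IsFiniteMeasure (μ.restrict (spanningSets μ n)) :=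
      ⟨by simpa using measure_spanningSets_lt_top μ n⟩
    have : IsFiniteMeasure (ν.restrict (spanningSets ν n)) :=
      ⟨by simpa using measure_spanningSets_lt_top ν n⟩
    refine ae_eq_zero_of_setIntegral_prod_finite ?_ fun A B hA hB => ?_
    · rw [Measure.prod_restrict]
      exact hint _ _ hmA hmB (measure_spanningSets_lt_top μ n) (measure_spanningSets_lt_top ν n)
    · rw [Measure.prod_restrict, Measure.restrict_restrict (hA.prod hB), Set.prod_inter_prod]
      exact h0 _ _ (hA.inter hmA) (hB.inter hmB)
        ((measure_mono Set.inter_subset_right).trans_lt (measure_spanningSets_lt_top μ n))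
        ((measure_mono Set.inter_subset_right).trans_lt (measure_spanningSets_lt_top ν n))
  filter_upwards [ae_all_iff.2 key] with p hp
  have h1 := mem_spanningSetsIndex μ p.1
  have h2 := mem_spanningSetsIndex ν p.2
  refine hp (max (spanningSetsIndex μ p.1) (spanningSetsIndex ν p.2)) ⟨?_, ?_⟩
  · exact monotone_spanningSets μ (le_max_left _ _) h1
  · exact monotone_spanningSets ν (le_max_right _ _) h2

end Rectangles

/-! ### Zeros of the determinant of a linear family of matrices -/

/-- On each line in the direction `ell`, `det B(λ + t ell) = det B(ell) · det (t + B(ell)⁻¹ B(λ))`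
is a nonzero polynomial in `t`, with finitely many zeros. Fubini then makes the zero set null. -/
theorem ae_det_ne_zero {k d : ℕ} (B : (Fin k → ℝ) →ₗ[ℝ] Matrix (Fin d) (Fin d) ℝ)
    {ell : Fin k → ℝ} (hell : (B ell).det ≠ 0) : ∀ᵐ lam : Fin k → ℝ, (B lam).det ≠ 0 := by
  have hBc : Continuous fun lam => (B lam).det := by
    have : Continuous B := B.continuous_of_finiteDimensional
    exact this.matrix_det
  set Z : Set ((Fin k → ℝ) × ℝ) := {p | (B (p.1 + p.2 • ell)).det = 0}
  have hZ : MeasurableSet Z := by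
    refine measurableSet_eq_fun ?_ measurable_const
    exact (hBc.comp (continuous_fst.add (continuous_snd.smul continuous_const))).measurable
  have hZ0 : (volume.prod volume : Measure ((Fin k → ℝ) × ℝ)) Z = 0 := by
    refine (Measure.measure_prod_null hZ).2 (Eventually.of_forall fun lam => ?_)
    refine Set.Finite.measure_zero ?_ _
    set M := (B ell)⁻¹ * (B lam)
    have hM : ∀ t : ℝ, t ∈ Prod.mk lam ⁻¹' Z → ((-M).charpoly).eval t = 0 := by
      intro t ht
      have ht' : (B (lam + t • ell)).det = 0 := ht
      have h1 : B (lam + t • ell) = B ell * (Matrix.scalar (Fin d) t - (-M)) := by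
        have h2 : B ell * (Matrix.scalar (Fin d) t) = t • B ell := by
          rw [Matrix.scalar_apply, ← Matrix.smul_one_eq_diagonal]; simp
        rw [mul_sub, h2, mul_neg, Matrix.mul_nonsing_inv_cancel_left _ _ (Ne.isUnit hell), map_add,
          map_smul, sub_neg_eq_add, add_comm]
      rw [h1, Matrix.det_mul] at ht'
      rw [Matrix.eval_charpoly]
      exact (mul_eq_zero.1 ht').resolve_left hell
    refine Set.Finite.subset ((-M).charpoly.roots.toFinset.finite_toSet) fun t ht => ?_
    simpa [(Matrix.charpoly_monic (-M)).ne_zero] using hM t ht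
  -- Slicing in the other order gives a `t` for which the translate by `t ell` of the zero set is
  -- null; translation invariance concludes.
  have hsw : (volume.prod volume : Measure (ℝ × (Fin k → ℝ))) (Prod.swap ⁻¹' Z) = 0 := by
    rw [(Measure.measurePreserving_swap (μ := (volume : Measure ℝ))
      (ν := (volume : Measure (Fin k → ℝ)))).measure_preimage hZ.nullMeasurableSet]
    exact hZ0
  obtain ⟨t, ht⟩ := (Measure.measure_ae_null_of_prod_null hsw).exists
  have h3 : (volume : Measure (Fin k → ℝ)) ((fun lam => lam + t • ell) ⁻¹' {lam | (B lam).det = 0}) = 0 :=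
    ht
  rw [measure_preimage_add_right] at h3
  simpa [ae_iff] using h3

/-! ### Characters -/

/-- The character `r ↦ exp (2πi r)` of `ℝ`. -/
def ech (r : ℝ) : ℂ := Complex.exp (2 * Real.pi * Complex.I * (r : ℂ))

theorem ech_eq (r : ℝ) : ech r = Complex.exp (((2 * Real.pi * r : ℝ) : ℂ) * Complex.I) := by
  rw [ech]; push_cast; ring_nf

@[simp] theorem norm_ech (r : ℝ) : ‖ech r‖ = 1 := by
  rw [ech_eq, Complex.norm_exp_ofReal_mul_I]

theorem ech_add (r s : ℝ) : ech (r + s) = ech r * ech s := by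
  rw [ech, ech, ech, ← Complex.exp_add]; push_cast; ring_nf

theorem conj_ech (r : ℝ) : conj (ech r) = ech (-r) := by
  rw [ech_eq, ech_eq, ← Complex.exp_conj]; simp [map_ofNat]

@[fun_prop] theorem continuous_ech : Continuous ech := by
  unfold ech; fun_prop

@[fun_prop] theorem measurable_ech : Measurable ech := continuous_ech.measurable

/-- The standard pairing on `ℝᵏ × ℝᵈ`. -/
def pairing {k d : ℕ} (p q : (Fin k → ℝ) × (Fin d → ℝ)) : ℝ := p.1 ⬝ᵥ q.1 + p.2 ⬝ᵥ q.2

@[fun_prop] theorem continuous_pairing {k d : ℕ} : Continuous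
    fun pq : ((Fin k → ℝ) × (Fin d → ℝ)) × ((Fin k → ℝ) × (Fin d → ℝ)) => pairing pq.1 pq.2 := by
  unfold pairing dotProduct; fun_prop

end TwoStep

namespace TwoStep

open scoped FourierTransform

/-! ### Pairs of nice functions related by the Fourier transform -/

variable {k d : ℕ}

instance : (volume : Measure ((Fin k → ℝ) × (Fin d → ℝ))).IsNegInvariant :=
  ⟨((Measure.measurePreserving_neg (volume : Measure (Fin k → ℝ))).prod
    (Measure.measurePreserving_neg (volume : Measure (Fin d → ℝ)))).map_eq⟩

/-- `g` and `φ` are nice functions and `φ` is the Fourier transform of `g`. -/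
structure IsFourierPair (g φ : (Fin k → ℝ) × (Fin d → ℝ) → ℂ) : Prop where
  cont_left : Continuous g
  cont_right : Continuous φ
  integrable_left : Integrable g
  integrable_right : Integrable φ
  memLp_left : MemLp g 2
  memLp_right : MemLp φ 2
  eq_left : ∀ ζ, g ζ = ∫ p, φ p * ech (pairing ζ p)
  eq_right : ∀ p, φ p = ∫ ζ, g ζ * ech (-pairing ζ p)

theorem pairing_comm (p q : (Fin k → ℝ) × (Fin d → ℝ)) : pairing p q = pairing q p := by
  simp [pairing, dotProduct_comm]

theorem pairing_neg_left (p q : (Fin k → ℝ) × (Fin d → ℝ)) : pairing (-p) q = -pairing p q := by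
  simp [pairing]; ring

/-- The inverse transform is the transform followed by a reflection. This lets a test function be
prescribed on either side. -/
theorem IsFourierPair.flip {g φ : (Fin k → ℝ) × (Fin d → ℝ) → ℂ} (h : IsFourierPair g φ) :
    IsFourierPair (fun p => φ (-p)) g where
  cont_left := h.cont_right.comp continuous_neg
  cont_right := h.cont_left
  integrable_left := h.integrable_right.comp_neg
  integrable_right := h.integrable_left
  memLp_left := h.memLp_right.comp_measurePreserving (Measure.measurePreserving_neg volume)
  memLp_right := h.memLp_left
  eq_left ζ := by
    rw [h.eq_right]
    refine integral_congr_ae (Eventually.of_forall fun p => ?_)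
    simp only [pairing_comm p, pairing_neg_left, neg_neg]
  eq_right p := by
    rw [h.eq_left, ← integral_neg_eq_self]
    refine integral_congr_ae (Eventually.of_forall fun q => ?_)
    simp only [pairing_comm p, pairing_neg_left]

/-- `ℝᵏ × ℝᵈ` as a Euclidean space. -/
def euclid (k d : ℕ) : EuclideanSpace ℝ (Fin k ⊕ Fin d) ≃L[ℝ] (Fin k → ℝ) × (Fin d → ℝ) :=
  (EuclideanSpace.equiv (Fin k ⊕ Fin d) ℝ).trans
    (LinearEquiv.sumArrowLequivProdArrow (Fin k) (Fin d) ℝ ℝ).toContinuousLinearEquiv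

theorem measurePreserving_euclid : MeasurePreserving (euclid k d) volume volume :=
  (volume_measurePreserving_sumPiEquivProdPi (fun _ : Fin k ⊕ Fin d => ℝ)).comp
    (EuclideanSpace.volume_preserving_symm_measurableEquiv_toLp (Fin k ⊕ Fin d))

theorem measurePreserving_euclid_symm : MeasurePreserving (euclid k d).symm volume volume :=
  MeasurePreserving.symm (euclid k d).toHomeomorph.toMeasurableEquiv measurePreserving_euclid

theorem inner_euclid (p q : EuclideanSpace ℝ (Fin k ⊕ Fin d)) :
    inner ℝ p q = pairing (euclid k d p) (euclid k d q) := by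
  rw [PiLp.inner_apply, Fintype.sum_sum_type]
  simp [pairing, dotProduct, euclid, mul_comm]

/-- Transported to Euclidean space the function is Schwartz, so Fourier inversion applies; `euclid`
preserves Lebesgue measure and turns the inner product into `pairing`. -/
theorem exists_isFourierPair {ψ : (Fin k → ℝ) × (Fin d → ℝ) → ℝ} (hψ : ContDiff ℝ (⊤ : ℕ∞) ψ)
    (hc : HasCompactSupport ψ) : ∃ φ, IsFourierPair (fun p => (ψ p : ℂ)) φ := by
  have h1 : ContDiff ℝ (⊤ : ℕ∞) fun p => (ψ (euclid k d p) : ℂ) :=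
    Complex.ofRealCLM.contDiff.comp (hψ.comp (euclid k d).contDiff)
  have h2 : HasCompactSupport fun p => (ψ (euclid k d p) : ℂ) :=
    (hc.comp_homeomorph (euclid k d).toHomeomorph).comp_left (g := fun x : ℝ => (x : ℂ)) (by simp)
  let G : SchwartzMap (EuclideanSpace ℝ (Fin k ⊕ Fin d)) ℂ := h2.toSchwartzMap h1
  have hG : ∀ p, G p = (ψ (euclid k d p) : ℂ) := fun _ => rfl
  have hG' : (fun p => (ψ p : ℂ)) = G ∘ (euclid k d).symm := by
    funext p; simp [hG]
  have emb : MeasurableEmbedding (euclid k d) := (euclid k d).toHomeomorph.measurableEmbedding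
  refine ⟨(𝓕 G : SchwartzMap _ ℂ) ∘ (euclid k d).symm, ?_, ?_, ?_, ?_, ?_, ?_, ?_, ?_⟩
  · exact hG' ▸ G.continuous.comp (euclid k d).symm.continuous
  · exact (𝓕 G).continuous.comp (euclid k d).symm.continuous
  · exact hG' ▸ measurePreserving_euclid_symm.integrable_comp_of_integrable G.integrable
  · exact measurePreserving_euclid_symm.integrable_comp_of_integrable (𝓕 G).integrable
  · exact hG' ▸ (G.memLp 2).comp_measurePreserving measurePreserving_euclid_symm
  · exact ((𝓕 G).memLp 2).comp_measurePreserving measurePreserving_euclid_symm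
  · intro ζ
    rw [← measurePreserving_euclid.integral_comp emb]
    have : (ψ ζ : ℂ) = 𝓕⁻ (𝓕 (G : _ → ℂ)) ((euclid k d).symm ζ) := by
      rw [G.continuous.fourierInv_fourier_eq G.integrable
        (by rw [← SchwartzMap.fourier_coe]; exact (𝓕 G).integrable), hG]
      simp
    rw [this, Real.fourierInv_eq']
    refine integral_congr_ae (Eventually.of_forall fun q => ?_)
    simp [inner_euclid, ech_eq, SchwartzMap.fourier_coe, mul_comm, pairing_comm ζ]
  · intro p
    rw [← measurePreserving_euclid.integral_comp emb]
    simp only [Function.comp_apply, SchwartzMap.fourier_coe]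
    rw [Real.fourier_eq']
    refine integral_congr_ae (Eventually.of_forall fun q => ?_)
    simp [inner_euclid, ech_eq, hG, mul_comm]

theorem exists_isFourierPair_right {ψ : (Fin k → ℝ) × (Fin d → ℝ) → ℝ}
    (hψ : ContDiff ℝ (⊤ : ℕ∞) ψ) (hc : HasCompactSupport ψ) :
    ∃ g, IsFourierPair g (fun p => (ψ p : ℂ)) := by
  obtain ⟨φ, hφ⟩ := exists_isFourierPair hψ hc
  exact ⟨_, hφ.flip⟩

/-! ### Totality of products of test functions and indicator functions -/

theorem memLp_two_mul_prod {α β : Type*} [MeasurableSpace α] [MeasurableSpace β] {μ : Measure α}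
    {ν : Measure β} [SFinite μ] [SFinite ν] {f : α → ℂ} {g : β → ℂ} (hf : MemLp f 2 μ) (hg : MemLp g 2 ν) :
    MemLp (fun p : α × β => f p.1 * g p.2) 2 (μ.prod ν) := by
  refine (memLp_two_iff_integrable_sq_norm (hf.1.comp_fst.mul hg.1.comp_snd)).2 ?_
  refine Integrable.congr (((memLp_two_iff_integrable_sq_norm hf.1).1 hf).mul_prod
    ((memLp_two_iff_integrable_sq_norm hg.1).1 hg)) (Eventually.of_forall fun p => ?_)
  simp [mul_pow]

/-- For fixed `B`, the function `p ↦ ∫_B h(p, x) dx` annihilates all smooth compactly supported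
functions, hence vanishes almost everywhere; so `h` integrates to zero over rectangles. This gives
totality of the test families on both sides of the Plancherel transform. -/
theorem ae_eq_zero_of_test {α β : Type*} [NormedAddCommGroup α] [NormedSpace ℝ α]
    [FiniteDimensional ℝ α] [MeasurableSpace α] [BorelSpace α] [MeasurableSpace β]
    {μ : Measure α} {ν : Measure β} [SigmaFinite μ] [IsFiniteMeasureOnCompacts μ]
    [SigmaFinite ν] {h : α × β → ℂ} (hh : MemLp h 2 (μ.prod ν))
    (h0 : ∀ ψ : α → ℝ, ContDiff ℝ (⊤ : ℕ∞) ψ → HasCompactSupport ψ → ∀ A, MeasurableSet A →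
      ν A < ⊤ → ∫ p, ((ψ p.1 : ℂ) * A.indicator 1 p.2) * h p ∂(μ.prod ν) = 0) :
    h =ᵐ[μ.prod ν] 0 := by
  have hint : ∀ A B, MeasurableSet A → MeasurableSet B → μ A < ⊤ → ν B < ⊤ →
      IntegrableOn h (A ×ˢ B) (μ.prod ν) := by
    intro A B hA hB hA' hB'
    have : IsFiniteMeasure ((μ.prod ν).restrict (A ×ˢ B)) :=
      ⟨by simpa [Measure.prod_prod] using ENNReal.mul_lt_top hA' hB'⟩
    exact (hh.restrict _).integrable one_le_two
  refine ae_eq_zero_of_setIntegral_prod hint fun A B hA hB hA' hB' => ?_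
  have hloc : LocallyIntegrable (fun p => ∫ x in B, h (p, x) ∂ν) μ := by
    rw [locallyIntegrable_iff]
    intro C hC
    have h1 := hint C B hC.measurableSet hB hC.measure_lt_top hB'
    rw [IntegrableOn, ← Measure.prod_restrict] at h1
    exact h1.integral_prod_left
  have hz : ∀ᵐ p ∂μ, ∫ x in B, h (p, x) ∂ν = 0 := by
    refine ae_eq_zero_of_integral_contDiff_smul_eq_zero hloc fun ψ hψ hc => ?_
    have h2 := h0 ψ hψ hc B hB hB'
    have hmem : MemLp (fun p : α × β => (ψ p.1 : ℂ) * B.indicator 1 p.2) 2 (μ.prod ν) := by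
      have hψ2 : MemLp (fun p => (ψ p : ℂ)) 2 μ :=
        (Complex.continuous_ofReal.comp hψ.continuous).memLp_of_hasCompactSupport
          (hc.comp_left (g := fun x : ℝ => (x : ℂ)) (by simp))
      exact memLp_two_mul_prod hψ2 (memLp_indicator_const 2 hB (1 : ℂ) (Or.inr hB'.ne))
    have h3 : Integrable (fun p : α × β => ((ψ p.1 : ℂ) * B.indicator 1 p.2) * h p) (μ.prod ν) :=
      hmem.integrable_mul hh
    rw [integral_prod _ h3] at h2
    rw [← h2]
    refine integral_congr_ae (Eventually.of_forall fun p => ?_)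
    simp only [Complex.real_smul]
    rw [← integral_indicator hB, ← integral_const_mul]
    refine integral_congr_ae (Eventually.of_forall fun x => ?_)
    by_cases hx : x ∈ B <;> simp [hx]
  have h1 := hint A B hA hB hA' hB'
  rw [IntegrableOn, ← Measure.prod_restrict] at h1
  rw [← Measure.prod_restrict, integral_prod _ h1]
  exact integral_eq_zero_of_ae (ae_restrict_of_ae hz)

end TwoStep

namespace TwoStep

/-! ### Parseval's identity for Fourier series on a cube -/

section FourierSeries

attribute [local instance] instMeasureSpaceUnitAddCircle

theorem mFourier_coe {ι : Type*} [Fintype ι] (n : ι → ℤ) (x : ι → ℝ) :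
    UnitAddTorus.mFourier (-n) (fun i => (x i : UnitAddCircle)) = ech (-∑ i, n i * x i) := by
  simp only [UnitAddTorus.mFourier, ContinuousMap.coe_mk, fourier_coe_apply, ech]
  rw [← Complex.exp_sum]
  push_cast
  rw [← Finset.sum_neg_distrib, Finset.mul_sum]
  congr 1
  refine Finset.sum_congr rfl fun i _ => ?_
  simp
  ring

/-- The cube `∏ᵢ (-1/2, 1/2]`. -/
def unitCube (ι : Type*) : Set (ι → ℝ) := {x | ∀ i, x i ∈ Set.Ioc (-(1 / 2) : ℝ) (1 / 2)}

theorem measurableSet_unitCube (ι : Type*) [Fintype ι] : MeasurableSet (unitCube ι) :=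
  MeasurableSet.univ_pi' fun _ => measurableSet_Ioc

theorem hasSum_unitCube {ι : Type*} [Fintype ι] {h : (ι → ℝ) → ℂ} (hm : Measurable h)
    (hh : MemLp h 2) :
    HasSum (fun n : ι → ℤ => ‖∫ x in unitCube ι, ech (-∑ i, n i * x i) * h x‖ ^ 2)
      (∫ x in unitCube ι, ‖h x‖ ^ 2) := by
  have hcube : unitCube ι = {x : ι → ℝ | ∀ i, x i ∈ Set.Ioc ((fun _ : ι => (-(1 / 2) : ℝ)) i)
      ((fun _ : ι => (-(1 / 2) : ℝ)) i + 1)} := by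
    norm_num [unitCube]
  -- The function on the torus that agrees with `h` on representatives in `(-1/2, 1/2]`; values of
  -- `h` off the cube play no role.
  let F : UnitAddTorus ι → ℂ := fun θ => h fun i => (AddCircle.equivIoc 1 (-(1 / 2) : ℝ) (θ i)).1
  have hF : ∀ x ∈ unitCube ι, F (fun i => (x i : UnitAddCircle)) = h x := by
    intro x hx
    simp only [F]
    congr 1
    funext i
    have hxi : x i ∈ Set.Ioc (-(1 / 2) : ℝ) (-(1 / 2) + 1) := by
      have := hx i
      norm_num at this ⊢
      exact this
    exact AddCircle.equivIoc_coe_of_mem hxi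
  have hFm : Measurable F := by
    refine hm.comp (measurable_pi_lambda _ fun i => ?_)
    exact measurable_subtype_coe.comp
      ((AddCircle.measurableEquivIoc 1 (-(1 / 2) : ℝ)).measurable.comp (measurable_pi_apply i))
  have hFL : MemLp F 2 := by
    refine ⟨hFm.aestronglyMeasurable, ?_⟩
    rw [eLpNorm_lt_top_iff_lintegral_rpow_enorm_lt_top two_ne_zero ENNReal.ofNat_ne_top,
      UnitAddTorus.lintegral_preimage _ (fun _ : ι => (-(1 / 2) : ℝ)), ← hcube,
      setLIntegral_congr_fun (measurableSet_unitCube ι)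
        (g := fun x => ‖h x‖ₑ ^ (2 : ENNReal).toReal) (fun x hx => by simp only [hF x hx])]
    exact (setLIntegral_le_lintegral _ _).trans_lt ((eLpNorm_lt_top_iff_lintegral_rpow_enorm_lt_top
      two_ne_zero ENNReal.ofNat_ne_top).1 hh.2)
  have h1 := UnitAddTorus.hasSum_sq_mFourierCoeff (hFL.toLp F)
  have h2 : ∫ t, ‖(hFL.toLp F) t‖ ^ 2 = ∫ x in unitCube ι, ‖h x‖ ^ 2 := by
    rw [integral_congr_ae (g := fun t => ‖F t‖ ^ 2)
      (hFL.coeFn_toLp.mono fun t ht => by simp only [ht]),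
      UnitAddTorus.integral_preimage _ (fun _ : ι => (-(1 / 2) : ℝ)), ← hcube]
    exact setIntegral_congr_fun (measurableSet_unitCube ι) fun x hx => by simp only [hF x hx]
  rw [h2] at h1
  convert h1 using 2 with n
  rw [show UnitAddTorus.mFourierCoeff (hFL.toLp F) n = UnitAddTorus.mFourierCoeff F n from
    integral_congr_ae (hFL.coeFn_toLp.mono fun t ht => by simp only [ht]),
    UnitAddTorus.mFourierCoeff_eq_integral _ _ (fun _ : ι => (-(1 / 2) : ℝ)), ← hcube]
  refine congrArg (fun z : ℂ => ‖z‖ ^ 2) (setIntegral_congr_fun (measurableSet_unitCube ι) fun x hx => ?_)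
  simp only [hF x hx, mFourier_coe, smul_eq_mul]

end FourierSeries

theorem hasSum_of_eq {ι : Type*} {f g : ι → ℝ} {a : ℝ} (h : HasSum f a)
    (hfg : ∀ i, g i = f i) : HasSum g a :=
  (funext hfg : g = f) ▸ h

/-- Rescaling by `2R` puts the support inside the unit cube. The Jacobian `(2R)^{-(k+d)}` enters the
squared coefficients twice and the squared norm once, which leaves one factor `(2R)^{k+d}`. -/
theorem hasSum_scaledCube {k d : ℕ} {R : ℝ} (hR : 0 < R) {h : (Fin k → ℝ) × (Fin d → ℝ) → ℂ}
    (hm : Measurable h) (hh : MemLp h 2)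
    (hs : ∀ p, h p ≠ 0 → (∀ i, |p.1 i| < R) ∧ ∀ j, |p.2 j| < R) :
    HasSum (fun n : (Fin k → ℤ) × (Fin d → ℤ) =>
        ‖∫ p, ech (-pairing p (fun i => (2 * R)⁻¹ * n.1 i, fun j => (2 * R)⁻¹ * n.2 j)) * h p‖ ^ 2)
      ((2 * R) ^ (k + d) * ∫ p, ‖h p‖ ^ 2) := by
  let e := MeasurableEquiv.sumPiEquivProdPi (fun _ : Fin k ⊕ Fin d => ℝ)
  have he : MeasurePreserving e volume volume :=
    volume_measurePreserving_sumPiEquivProdPi (fun _ : Fin k ⊕ Fin d => ℝ)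
  have hinv : |((2 * R) ^ finrank ℝ (Fin k ⊕ Fin d → ℝ))⁻¹| = ((2 * R) ^ (k + d))⁻¹ := by
    rw [abs_of_pos (by positivity)]
    simp
  have h2 : MemLp (fun x => h (e ((2 * R) • x))) 2 := by
    have h3 : MemLp (h ∘ e) 2 := hh.comp_measurePreserving he
    have hms : Measurable fun x : Fin k ⊕ Fin d → ℝ => h (e ((2 * R) • x)) :=
      hm.comp (e.measurable.comp (measurable_const_smul _))
    rw [memLp_two_iff_integrable_sq_norm hms.aestronglyMeasurable]
    exact ((memLp_two_iff_integrable_sq_norm h3.1).1 h3).comp_smul (by positivity : 2 * R ≠ 0)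
  have hsupp : ∀ x, x ∉ unitCube (Fin k ⊕ Fin d) → h (e ((2 * R) • x)) = 0 := by
    intro x hx
    by_contra h0
    refine hx fun i => ?_
    have h1 := hs _ h0
    have h4 : ∀ i, |2 * R * x i| < R := by
      rintro (i | i)
      · exact h1.1 i
      · exact h1.2 i
    have h5 := abs_lt.1 (h4 i)
    constructor <;> nlinarith
  have h1 := hasSum_unitCube (hm.comp (e.measurable.comp (measurable_const_smul (2 * R)))) h2
  have hint : ∀ w : (Fin k → ℝ) × (Fin d → ℝ) → ℂ,
      ∫ x, w (e ((2 * R) • x)) = (((2 * R) ^ (k + d))⁻¹ : ℝ) • ∫ p, w p := by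
    intro w
    rw [Measure.integral_comp_smul volume (fun x => w (e x)), hinv, he.integral_comp']
  have hintr : ∀ w : (Fin k → ℝ) × (Fin d → ℝ) → ℝ,
      ∫ x, w (e ((2 * R) • x)) = (((2 * R) ^ (k + d))⁻¹ : ℝ) • ∫ p, w p := by
    intro w
    rw [Measure.integral_comp_smul volume (fun x => w (e x)), hinv, he.integral_comp']
  have hcoef : ∀ n : (Fin k → ℤ) × (Fin d → ℤ),
      ∫ x in unitCube (Fin k ⊕ Fin d), ech (-∑ i, (Sum.elim n.1 n.2 i : ℤ) * x i) *
        h (e ((2 * R) • x)) = (((2 * R) ^ (k + d))⁻¹ : ℝ) • ∫ p,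
          ech (-pairing p (fun i => (2 * R)⁻¹ * n.1 i, fun j => (2 * R)⁻¹ * n.2 j)) * h p := by
    intro n
    rw [setIntegral_eq_integral_of_forall_compl_eq_zero fun x hx => by rw [hsupp x hx, mul_zero],
      ← hint]
    refine integral_congr_ae (Eventually.of_forall fun x => ?_)
    simp only
    congr 2
    rw [Fintype.sum_sum_type, neg_inj]
    simp only [pairing, dotProduct]
    congr 1 <;> refine Finset.sum_congr rfl fun i _ => ?_ <;>
      simp [e, MeasurableEquiv.sumPiEquivProdPi] <;> field_simp
  have hsq : ∫ x in unitCube (Fin k ⊕ Fin d), ‖h (e ((2 * R) • x))‖ ^ 2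
      = (((2 * R) ^ (k + d))⁻¹ : ℝ) • ∫ p, ‖h p‖ ^ 2 := by
    rw [setIntegral_eq_integral_of_forall_compl_eq_zero fun x hx => by simp [hsupp x hx],
      ← hintr fun p => ‖h p‖ ^ 2]
  simp only [Function.comp_apply] at h1
  rw [hsq] at h1
  have h6 := (Equiv.sumArrowEquivProdArrow (Fin k) (Fin d) ℤ).symm.hasSum_iff.2 h1
  have h7 := h6.mul_left (((2 * R) ^ (k + d)) ^ 2)
  have hne : (2 * R) ^ (k + d) ≠ 0 := by positivity
  have htot : (2 * R) ^ (k + d) * ∫ p, ‖h p‖ ^ 2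
      = ((2 * R) ^ (k + d)) ^ 2 * (((2 * R) ^ (k + d))⁻¹ • ∫ p, ‖h p‖ ^ 2) := by
    rw [smul_eq_mul]
    field_simp
  rw [htot]
  refine hasSum_of_eq h7 fun n => ?_
  rw [Function.comp_apply,
    show (Equiv.sumArrowEquivProdArrow (Fin k) (Fin d) ℤ).symm n = Sum.elim n.1 n.2 from rfl]
  rw [hcoef n, norm_smul, Real.norm_of_nonneg (by positivity)]
  field_simp

end TwoStep

namespace TwoStep

open scoped Matrix

variable {𝔫 : Type*} [LieRing 𝔫] [LieAlgebra ℝ 𝔫] {k d : ℕ} (v : Basis (Idx k d) ℝ 𝔫)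

/-! ### The matrices `B(λ)` -/

/-- The linear map `λ ↦ B(λ)`. -/
def matBLin : (Fin k → ℝ) →ₗ[ℝ] Matrix (Fin d) (Fin d) ℝ where
  toFun := matB v
  map_add' a b := by
    ext i j
    simp [matB, dualOf, add_smul, Finset.sum_add_distrib]
    ring
  map_smul' c a := by
    ext i j
    simp [matB, dualOf, mul_assoc, Finset.mul_sum]

theorem continuous_matB : Continuous (matB v) :=
  (matBLin v).continuous_of_finiteDimensional

theorem continuous_vecMul_matB :
    Continuous fun p : (Fin k → ℝ) × (Fin d → ℝ) => p.2 ᵥ* matB v p.1 :=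
  continuous_snd.matrix_vecMul ((continuous_matB v).comp continuous_fst)

theorem continuous_det_matB : Continuous fun lam => (matB v lam).det :=
  (continuous_matB v).matrix_det

/-- With this sign, the commutator term of the group law shows up in the phases as a translation of
`s B(λ)`. -/
theorem dotProduct_lieXY (lam : Fin k → ℝ) (x y : Fin d → ℝ) :
    lam ⬝ᵥ lieXY v x y = -((x ᵥ* matB v lam) ⬝ᵥ y) := by
  have h : lam ⬝ᵥ lieXY v x y = dualOf v lam ⁅xVec v x, yVec v y⁆ := by
    simp [dualOf, lieXY, dotProduct]
  rw [h, ← Matrix.dotProduct_mulVec]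
  simp only [xVec, yVec, sum_lie, lie_sum, smul_lie, lie_smul, map_sum, map_smul, dotProduct,
    Matrix.mulVec, matB, Matrix.of_apply, smul_eq_mul, Finset.mul_sum, neg_mul, mul_neg,
    Finset.sum_neg_distrib, neg_neg]
  rw [Finset.sum_comm]
  refine Finset.sum_congr rfl fun i _ => Finset.sum_congr rfl fun j _ => ?_
  ring

/-- If `B(λ) y = 0` for the restriction `λ` of `ℓ` to the centre, then `ℓ[∑ yⱼ Yⱼ, b] = 0` for all
`b`, as the `Yⱼ` commute. So `∑ yⱼ Yⱼ` is central, and `y = 0`. One such `λ` suffices, since the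
zeros of the determinant are then null. -/
theorem IsAdapted.ae_det_ne_zero {v : Basis (Idx k d) ℝ 𝔫} (hv : IsAdapted v) :
    ∀ᵐ lam : Fin k → ℝ, (matB v lam).det ≠ 0 := by
  obtain ⟨ell, hell⟩ := hv.sq_integrable
  set lam : Fin k → ℝ := fun l => ell (Zb v l) with hlam
  have hcen : ∀ a ∈ LieAlgebra.center ℝ 𝔫, dualOf v lam a = ell a := by
    intro a ha
    rw [← hv.repr_center ha]
    simp [zVec, dualOf, hlam, Zb, Finsupp.single_apply]
  refine TwoStep.ae_det_ne_zero (matBLin v) (ell := lam) fun h0 => ?_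
  obtain ⟨y, hy0, hy⟩ := Matrix.exists_mulVec_eq_zero_iff.2 h0
  have hmem : yVec v y ∈ LieAlgebra.center ℝ 𝔫 := by
    refine hell _ fun b => ?_
    rw [← vec_repr v b, lie_add, lie_add, lie_center_right (hv.zVec_mem _)]
    have h1 : ∀ y', ⁅yVec v y, yVec v y'⁆ = 0 := fun y' => by
      simp [yVec, sum_lie, lie_sum, hv.lie_Y_Y]
    rw [h1, zero_add, zero_add, ← lie_skew, map_neg, ← hcen _ (hv.two_step _ _)]
    set x : Fin d → ℝ := fun i => v.repr b (Sum.inr (Sum.inr i))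
    have h2 := dotProduct_lieXY v lam x y
    rw [← Matrix.dotProduct_mulVec, show matB v lam *ᵥ y = 0 from hy] at h2
    have h : lam ⬝ᵥ lieXY v x y = dualOf v lam ⁅xVec v x, yVec v y⁆ := by
      simp [dualOf, lieXY, dotProduct]
    rw [← h, h2]
    simp
  -- A central vector equals its own `Z`-part, so its `Y`-coordinates vanish (`h5`); they are also
  -- the entries of `y` (`h4`).
  have h3 := hv.repr_center hmem
  have h4 := (repr_vec v 0 y 0).2.1
  have h5 := (repr_vec v (fun l => v.repr (yVec v y) (Sum.inl l)) 0 0).2.1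
  have hx : xVec v 0 = 0 := by simp [xVec]
  have hy' : yVec v 0 = 0 := by simp [yVec]
  have hz : zVec v 0 = 0 := by simp [zVec]
  rw [hx, hy', add_zero, add_zero, h3] at h5
  rw [hz, hx, add_zero, zero_add] at h4
  exact hy0 (h4.symm.trans h5)

/-! ### The change of variables `(λ, s, t) ↦ (λ, s B(λ), s - t)` -/

/-- The map `(λ, s, t) ↦ (λ, s B(λ), s - t)`. -/
def psi (p : (Fin k → ℝ) × (Fin d → ℝ) × (Fin d → ℝ)) :
    ((Fin k → ℝ) × (Fin d → ℝ)) × (Fin d → ℝ) :=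
  ((p.1, p.2.1 ᵥ* matB v p.1), p.2.1 - p.2.2)

/-- The inverse of the map `(λ, s, t) ↦ (λ, s B(λ), s - t)`. -/
def psiInv (q : ((Fin k → ℝ) × (Fin d → ℝ)) × (Fin d → ℝ)) :
    (Fin k → ℝ) × (Fin d → ℝ) × (Fin d → ℝ) :=
  (q.1.1, q.1.2 ᵥ* (matB v q.1.1)⁻¹, q.1.2 ᵥ* (matB v q.1.1)⁻¹ - q.2)

theorem measurable_psi : Measurable (psi v) := by
  refine Continuous.measurable ?_
  have h : Continuous fun p : (Fin k → ℝ) × (Fin d → ℝ) × (Fin d → ℝ) => p.2.1 ᵥ* matB v p.1 :=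
    (continuous_vecMul_matB v).comp (continuous_fst.prodMk (continuous_fst.comp continuous_snd))
  unfold psi
  fun_prop

/-- Write the inverse as `det⁻¹ • adjugate`: measurable everywhere, including the singular matrices,
where it is zero. -/
theorem measurable_vecMul_matB_inv :
    Measurable fun q : (Fin k → ℝ) × (Fin d → ℝ) => q.2 ᵥ* (matB v q.1)⁻¹ := by
  have h : (fun q : (Fin k → ℝ) × (Fin d → ℝ) => q.2 ᵥ* (matB v q.1)⁻¹)
      = fun q => ((matB v q.1).det)⁻¹ • (q.2 ᵥ* (matB v q.1).adjugate) := by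
    funext q
    rw [Matrix.inv_def, Matrix.vecMul_smul, Ring.inverse_eq_inv']
  rw [h]
  have h1 : Measurable fun q : (Fin k → ℝ) × (Fin d → ℝ) => ((matB v q.1).det)⁻¹ :=
    ((continuous_det_matB v).comp continuous_fst).measurable.inv
  have h2 : Measurable fun q : (Fin k → ℝ) × (Fin d → ℝ) => q.2 ᵥ* (matB v q.1).adjugate :=
    (continuous_snd.matrix_vecMul
      ((continuous_matB v).comp continuous_fst).matrix_adjugate).measurable
  exact h1.smul h2

theorem measurable_psiInv : Measurable (psiInv v) := by
  have h := (measurable_vecMul_matB_inv v).comp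
    (measurable_fst : Measurable (Prod.fst : ((Fin k → ℝ) × (Fin d → ℝ)) × (Fin d → ℝ) → _))
  exact (measurable_fst.comp measurable_fst).prodMk (h.prodMk (h.sub measurable_snd))

theorem psiInv_psi {p : (Fin k → ℝ) × (Fin d → ℝ) × (Fin d → ℝ)} (hp : (matB v p.1).det ≠ 0) :
    psiInv v (psi v p) = p := by
  simp [psi, psiInv, Matrix.vecMul_vecMul, Matrix.mul_nonsing_inv _ (Ne.isUnit hp)]

theorem lintegral_vecMul {M : Matrix (Fin d) (Fin d) ℝ} (hM : M.det ≠ 0)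
    {F : (Fin d → ℝ) → ENNReal} (hF : Measurable F) :
    ENNReal.ofReal |M.det| * ∫⁻ s, F (s ᵥ* M) = ∫⁻ x, F x := by
  have hM' : M.transpose.det ≠ 0 := by rwa [Matrix.det_transpose]
  have h1 := Real.map_matrix_volume_pi_eq_smul_volume_pi hM'
  have h2 : ∫⁻ s, F (s ᵥ* M) = ∫⁻ x, F x ∂(Measure.map (Matrix.toLin' M.transpose) volume) := by
    rw [lintegral_map hF (LinearMap.continuous_of_finiteDimensional _).measurable]
    simp [Matrix.mulVec_transpose]
  rw [h2, h1, lintegral_smul_measure, smul_eq_mul, ← mul_assoc, ← ENNReal.ofReal_mul (abs_nonneg _),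
    ← abs_mul, Matrix.det_transpose, mul_inv_cancel₀ hM]
  simp

variable {v}

theorem ae_plancherel_det_ne_zero : ∀ᵐ lam ∂(plancherelMeasure v), (matB v lam).det ≠ 0 := by
  rw [plancherelMeasure, ae_withDensity_iff (by
    exact (continuous_det_matB v).abs.measurable.ennreal_ofReal)]
  refine Eventually.of_forall fun lam h h0 => h ?_
  simp [h0]

/-- For fixed `λ`, the map `t ↦ s - t` preserves Lebesgue measure, and `s ↦ s B(λ)` has a Jacobian
matched exactly by the density of the Plancherel measure. Singular `λ` are negligible. -/
theorem IsAdapted.measurePreserving_psi (hv : IsAdapted v) :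
    MeasurePreserving (psi v) ((plancherelMeasure v).prod volume) volume := by
  refine ⟨measurable_psi v, Measure.ext_of_lintegral _ fun F hF => ?_⟩
  have hd : Measurable fun lam => ENNReal.ofReal |(matB v lam).det| :=
    (continuous_det_matB v).abs.measurable.ennreal_ofReal
  have hFp : Measurable fun p => F (psi v p) := hF.comp (measurable_psi v)
  rw [lintegral_map hF (measurable_psi v), lintegral_prod _ hFp.aemeasurable, plancherelMeasure,
    lintegral_withDensity_eq_lintegral_mul _ hd hFp.lintegral_prod_right']
  rw [Measure.volume_eq_prod ((Fin k → ℝ) × (Fin d → ℝ)), lintegral_prod _ hF.aemeasurable,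
    Measure.volume_eq_prod (Fin k → ℝ), lintegral_prod _ hF.lintegral_prod_right'.aemeasurable]
  refine lintegral_congr_ae ?_
  filter_upwards [hv.ae_det_ne_zero] with lam hlam
  have h1 : ∀ s : Fin d → ℝ, ∫⁻ t, F (psi v (lam, s, t)) = ∫⁻ x, F ((lam, s ᵥ* matB v lam), x) := by
    intro s
    exact lintegral_sub_left_eq_self (fun x => F ((lam, s ᵥ* matB v lam), x)) s
  have hG : Measurable fun ξ : Fin d → ℝ => ∫⁻ x, F ((lam, ξ), x) :=
    hF.lintegral_prod_right'.comp measurable_prodMk_left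
  have hFl : Measurable fun q : (Fin d → ℝ) × (Fin d → ℝ) => F (psi v (lam, q)) :=
    hFp.comp measurable_prodMk_left
  rw [Pi.mul_apply, Measure.volume_eq_prod (Fin d → ℝ), lintegral_prod _ hFl.aemeasurable]
  simp only [h1]
  exact lintegral_vecMul hlam hG

/-- Since `psi` already pushes the one measure to the other, it is enough that `psiInv` is an almost
everywhere left inverse. -/
theorem IsAdapted.measurePreserving_psiInv (hv : IsAdapted v) :
    MeasurePreserving (psiInv v) volume ((plancherelMeasure v).prod volume) := by
  refine ⟨measurable_psiInv v, ?_⟩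
  rw [← hv.measurePreserving_psi.map_eq, Measure.map_map (measurable_psiInv v) (measurable_psi v)]
  have h : ∀ᵐ p ∂((plancherelMeasure v).prod volume), (psiInv v ∘ psi v) p = id p := by
    have h1 := (Measure.quasiMeasurePreserving_fst (μ := plancherelMeasure v)
      (ν := (volume : Measure ((Fin d → ℝ) × (Fin d → ℝ))))).ae
      (ae_plancherel_det_ne_zero (v := v))
    filter_upwards [h1] with p hp using psiInv_psi v hp
  rw [Measure.map_congr h, Measure.map_id]

end TwoStep

namespace TwoStep

open scoped Matrix

/-! ### The partial Fourier transform -/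

section PartialFourier

variable {k d : ℕ} {X : Type*} [MeasurableSpace X]

/-- The inverse Fourier transform in the first variable. -/
def pft (f : ((Fin k → ℝ) × (Fin d → ℝ)) × X → ℂ) (q : ((Fin k → ℝ) × (Fin d → ℝ)) × X) : ℂ :=
  ∫ p, f (p, q.2) * ech (pairing q.1 p)

theorem measurable_pft {f : ((Fin k → ℝ) × (Fin d → ℝ)) × X → ℂ} (hf : Measurable f) :
    Measurable (pft f) := by
  have h : Measurable fun qp : (((Fin k → ℝ) × (Fin d → ℝ)) × X) × ((Fin k → ℝ) × (Fin d → ℝ)) =>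
      f (qp.2, qp.1.2) * ech (pairing qp.1.1 qp.2) := by
    refine (hf.comp (measurable_snd.prodMk (measurable_snd.comp measurable_fst))).mul
      (measurable_ech.comp (continuous_pairing.measurable.comp
        ((measurable_fst.comp measurable_fst).prodMk measurable_snd)))
  exact (h.stronglyMeasurable.integral_prod_right').measurable

variable {ν : Measure X} [SFinite ν]

/-- The value at `(ζ, x)` depends only on the slice `f(·, x)`, so the exceptional set involves `x`
alone and serves every `ζ` at once. -/
theorem ae_pft_congr {f g : ((Fin k → ℝ) × (Fin d → ℝ)) × X → ℂ}
    (h : f =ᵐ[(volume : Measure ((Fin k → ℝ) × (Fin d → ℝ))).prod ν] g) :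
    ∀ᵐ x ∂ν, ∀ ζ, pft f (ζ, x) = pft g (ζ, x) := by
  have h1 := (Measure.measurePreserving_swap (μ := ν)
    (ν := (volume : Measure ((Fin k → ℝ) × (Fin d → ℝ))))).quasiMeasurePreserving.ae h
  filter_upwards [Measure.ae_ae_of_ae_prod h1] with x hx ζ
  refine integral_congr_ae ?_
  filter_upwards [hx] with p hp
  simp only [Prod.swap_prod_mk] at hp
  simp only [hp]

omit [SFinite ν] in
theorem ae_of_ae_right {p : ((Fin k → ℝ) × (Fin d → ℝ)) × X → Prop}
    (h : ∀ᵐ x ∂ν, ∀ ζ, p (ζ, x)) :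
    ∀ᵐ q ∂((volume : Measure ((Fin k → ℝ) × (Fin d → ℝ))).prod ν), p q :=
  (Measure.quasiMeasurePreserving_snd.ae h).mono fun q hq => hq q.1

theorem pft_congr_ae {f g : ((Fin k → ℝ) × (Fin d → ℝ)) × X → ℂ}
    (h : f =ᵐ[(volume : Measure ((Fin k → ℝ) × (Fin d → ℝ))).prod ν] g) :
    ∀ᵐ q ∂((volume : Measure ((Fin k → ℝ) × (Fin d → ℝ))).prod ν), pft f q = pft g q :=
  ae_of_ae_right (p := fun q => pft f q = pft g q) (ae_pft_congr h)

theorem ae_integrable_slice {f : ((Fin k → ℝ) × (Fin d → ℝ)) × X → ℂ}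
    (hf : Integrable f ((volume : Measure ((Fin k → ℝ) × (Fin d → ℝ))).prod ν)) :
    ∀ᵐ x ∂ν, ∀ ζ, Integrable fun p => f (p, x) * ech (pairing ζ p) := by
  filter_upwards [hf.prod_left_ae] with x hx ζ
  refine hx.mul_bdd (c := 1) ?_ (Eventually.of_forall fun p => by simp)
  exact (continuous_ech.comp (continuous_pairing.comp
    (continuous_const.prodMk continuous_id))).aestronglyMeasurable

theorem pft_add_smul {f g : ((Fin k → ℝ) × (Fin d → ℝ)) × X → ℂ} (c : ℂ)
    (hf : Integrable f ((volume : Measure ((Fin k → ℝ) × (Fin d → ℝ))).prod ν))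
    (hg : Integrable g ((volume : Measure ((Fin k → ℝ) × (Fin d → ℝ))).prod ν)) :
    ∀ᵐ q ∂((volume : Measure ((Fin k → ℝ) × (Fin d → ℝ))).prod ν),
      pft (fun q => f q + c * g q) q = pft f q + c * pft g q := by
  refine ae_of_ae_right ?_
  filter_upwards [ae_integrable_slice hf, ae_integrable_slice hg] with x hx hx' ζ
  simp only [pft]
  rw [← integral_const_mul, ← integral_add (hx ζ) ((hx' ζ).const_mul c)]
  refine integral_congr_ae (Eventually.of_forall fun p => ?_)
  simp only
  ring

omit [MeasurableSpace X] in
theorem pft_mul_indicator {g φ : (Fin k → ℝ) × (Fin d → ℝ) → ℂ} (h : IsFourierPair g φ)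
    (a : X → ℂ) (q : ((Fin k → ℝ) × (Fin d → ℝ)) × X) :
    pft (fun q => φ q.1 * a q.2) q = g q.1 * a q.2 := by
  rw [pft, h.eq_left, ← integral_mul_const]
  refine integral_congr_ae (Eventually.of_forall fun p => ?_)
  simp only
  ring

/-- The partial Fourier transform is symmetric with respect to Fourier pairs. -/
theorem integral_conj_mul_pft {g φ : (Fin k → ℝ) × (Fin d → ℝ) → ℂ} (h : IsFourierPair g φ)
    {f : ((Fin k → ℝ) × (Fin d → ℝ)) × X → ℂ} (hfm : Measurable f)
    (hf : Integrable f ((volume : Measure ((Fin k → ℝ) × (Fin d → ℝ))).prod ν))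
    {a : X → ℂ} (ha : Measurable a) (ha1 : ∀ x, ‖a x‖ ≤ 1) :
    ∫ q, conj (g q.1 * a q.2) * pft f q ∂((volume : Measure ((Fin k → ℝ) × (Fin d → ℝ))).prod ν)
      = ∫ q, conj (φ q.1 * a q.2) * f q
          ∂((volume : Measure ((Fin k → ℝ) × (Fin d → ℝ))).prod ν) := by
  have hechm : Measurable fun r : ((Fin k → ℝ) × (Fin d → ℝ)) × (((Fin k → ℝ) × (Fin d → ℝ)) × X) =>
      ech (pairing r.1 r.2.1) :=
    measurable_ech.comp (continuous_pairing.measurable.comp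
      (measurable_fst.prodMk (measurable_fst.comp measurable_snd)))
  -- The integrand of both sides before any integration. It is dominated by `‖g(ζ)‖ ‖f(r)‖`, with
  -- `g` and `f` integrable, so Fubini applies.
  let J : ((Fin k → ℝ) × (Fin d → ℝ)) × (((Fin k → ℝ) × (Fin d → ℝ)) × X) → ℂ :=
    fun r => conj (g r.1 * a r.2.2) * (f r.2 * ech (pairing r.1 r.2.1))
  have hgm := h.cont_left.measurable
  have hJm : Measurable J :=
    (Complex.continuous_conj.measurable.comp ((hgm.comp measurable_fst).mul
      (ha.comp (measurable_snd.comp measurable_snd)))).mul ((hfm.comp measurable_snd).mul hechm)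
  have hJn : ∀ r, ‖J r‖ ≤ ‖g r.1 * f r.2‖ := fun r => by
    simp only [J, norm_mul, RCLike.norm_conj, norm_ech, mul_one]
    have := ha1 r.2.2
    have h0 := norm_nonneg (g r.1)
    gcongr
    nlinarith
  have hJ : Integrable J (volume.prod (volume.prod ν)) :=
    (h.integrable_left.mul_prod hf).mono hJm.aestronglyMeasurable (Eventually.of_forall hJn)
  have hJs : ∀ ζ, Integrable (fun r => J (ζ, r)) (volume.prod ν) := fun ζ =>
    (hf.const_mul (g ζ)).mono (hJm.comp measurable_prodMk_left).aestronglyMeasurable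
      (Eventually.of_forall fun r => hJn (ζ, r))
  -- `pft f` itself need not be integrable, but it is bounded in `ζ` by `∫ ‖f(p, x)‖ dp`, and the
  -- factor `g` supplies the decay in `ζ`.
  have hL : Integrable (fun q => conj (g q.1 * a q.2) * pft f q)
      ((volume : Measure ((Fin k → ℝ) × (Fin d → ℝ))).prod ν) := by
    refine (h.integrable_left.norm.mul_prod hf.norm.integral_prod_right).mono' ?_
      (Eventually.of_forall fun q => ?_)
    · exact ((Complex.continuous_conj.measurable.comp ((hgm.comp measurable_fst).mul
        (ha.comp measurable_snd))).mul (measurable_pft hfm)).aestronglyMeasurable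
    · rw [norm_mul, RCLike.norm_conj, norm_mul]
      have h1 : ‖pft f q‖ ≤ ∫ p, ‖f (p, q.2)‖ := by
        refine (norm_integral_le_integral_norm _).trans_eq ?_
        simp
      have h2 : ‖g q.1‖ * ‖a q.2‖ ≤ ‖g q.1‖ := mul_le_of_le_one_right (norm_nonneg _) (ha1 _)
      exact mul_le_mul h2 h1 (norm_nonneg _) (norm_nonneg _)
  rw [integral_prod _ hL]
  have h3 : ∀ ζ, ∫ x, conj (g (ζ, x).1 * a (ζ, x).2) * pft f (ζ, x) ∂ν
      = ∫ r, J (ζ, r) ∂((volume : Measure ((Fin k → ℝ) × (Fin d → ℝ))).prod ν) := by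
    intro ζ
    rw [integral_prod_symm _ (hJs ζ)]
    refine integral_congr_ae (Eventually.of_forall fun x => ?_)
    simp only [pft, J]
    rw [integral_const_mul]
  simp only [h3]
  rw [integral_integral_swap (f := fun ζ r => J (ζ, r)) hJ]
  refine integral_congr_ae (Eventually.of_forall fun r => ?_)
  simp only [J]
  rw [h.eq_right, map_mul, ← integral_conj, ← integral_mul_const, ← integral_mul_const]
  refine integral_congr_ae (Eventually.of_forall fun ζ => ?_)
  simp only [map_mul, conj_ech, neg_neg]
  ring

end PartialFourier

end TwoStep

namespace TwoStep

open scoped Matrix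

variable {𝔫 : Type*} [LieRing 𝔫] [LieAlgebra ℝ 𝔫] {k d : ℕ} (v : Basis (Idx k d) ℝ 𝔫)

/-! ### The operators `∫ f(n) π_λ(n) dn` as integral operators -/

theorem repFun_eq (lam : Fin k → ℝ) (n : Grp v) (F : (Fin d → ℝ) → ℂ) (s : Fin d → ℝ) :
    repFun v lam n F s = ech (pairing (lam, s ᵥ* matB v lam) (n.1, n.2.1)) * F (s - n.2.2) := by
  rw [repFun, ech, pairing, Matrix.dotProduct_mulVec]

theorem inner_rep (lam : Fin k → ℝ) (n : Grp v) (w₁ w₂ : L2R d) :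
    inner ℂ w₂ (rep v lam n w₁) = ∫ s, ech (pairing (lam, s ᵥ* matB v lam) (n.1, n.2.1)) *
      w₁ (s - n.2.2) * conj (w₂ s) := by
  rw [L2.inner_def]
  refine integral_congr_ae ?_
  filter_upwards [(memLp_repFun v lam n w₁).coeFn_toLp] with s hs
  rw [RCLike.inner_apply, rep, hs, repFun_eq]

/-- The group `N` in the coordinates `((z, y), x)`. -/
def coords (n : Grp v) : ((Fin k → ℝ) × (Fin d → ℝ)) × (Fin d → ℝ) := ((n.1, n.2.1), n.2.2)

theorem measurePreserving_coords : MeasurePreserving (coords v) volume volume :=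
  volume_preserving_prodAssoc.symm

theorem measurableEmbedding_coords : MeasurableEmbedding (coords v) :=
  (MeasurableEquiv.prodAssoc (α := Fin k → ℝ) (β := Fin d → ℝ)
    (γ := Fin d → ℝ)).symm.measurableEmbedding

theorem integral_coords (F : ((Fin k → ℝ) × (Fin d → ℝ)) × (Fin d → ℝ) → ℂ) :
    ∫ n : Grp v, F (coords v n) = ∫ q, F q :=
  (measurePreserving_coords v).integral_comp (measurableEmbedding_coords v) F

/-- The kernel of `n ↦ ⟨π_λ(n) w₁, w₂⟩` as a function on `N × ℝᵈ`. -/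
theorem integrable_matrixCoeff {f : ((Fin k → ℝ) × (Fin d → ℝ)) × (Fin d → ℝ) → ℂ}
    (hfm : Measurable f) (hf : Integrable f) (lam : Fin k → ℝ) (w₁ w₂ : L2R d) :
    Integrable fun r : (((Fin k → ℝ) × (Fin d → ℝ)) × (Fin d → ℝ)) × (Fin d → ℝ) =>
      f r.1 * ech (pairing (lam, r.2 ᵥ* matB v lam) r.1.1) * w₁ (r.2 - r.1.2) * conj (w₂ r.2) := by
  have hw₁ : Measurable w₁ := (Lp.stronglyMeasurable w₁).measurable
  have hw₂ : Measurable w₂ := (Lp.stronglyMeasurable w₂).measurable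
  have hp : Continuous fun r : (((Fin k → ℝ) × (Fin d → ℝ)) × (Fin d → ℝ)) × (Fin d → ℝ) =>
      pairing (lam, r.2 ᵥ* matB v lam) r.1.1 := by
    refine continuous_pairing.comp (Continuous.prodMk (continuous_const.prodMk ?_)
      (continuous_fst.comp continuous_fst))
    exact continuous_snd.matrix_vecMul continuous_const
  have hm : Measurable fun r : (((Fin k → ℝ) × (Fin d → ℝ)) × (Fin d → ℝ)) × (Fin d → ℝ) =>
      f r.1 * ech (pairing (lam, r.2 ᵥ* matB v lam) r.1.1) * w₁ (r.2 - r.1.2) * conj (w₂ r.2) := by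
    have h1 : Measurable fun r : (((Fin k → ℝ) × (Fin d → ℝ)) × (Fin d → ℝ)) × (Fin d → ℝ) =>
      f r.1 := hfm.comp measurable_fst
    have h2 := measurable_ech.comp hp.measurable
    exact ((h1.mul h2).mul (hw₁.comp (measurable_snd.sub (measurable_snd.comp measurable_fst)))).mul
      (Complex.continuous_conj.measurable.comp (hw₂.comp measurable_snd))
  have hL₁ : ∀ x : Fin d → ℝ, MemLp (fun s => w₁ (s - x)) 2 := fun x =>
    (Lp.memLp w₁).comp_measurePreserving (measurePreserving_sub_right volume x)
  have hsq₁ : ∀ x : Fin d → ℝ, Integrable (fun s => ‖w₁ (s - x)‖ ^ 2) := fun x =>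
    (memLp_two_iff_integrable_sq_norm (hL₁ x).1).1 (hL₁ x)
  have hsq₂ : Integrable (fun s => ‖w₂ s‖ ^ 2) :=
    (memLp_two_iff_integrable_sq_norm (Lp.memLp w₂).1).1 (Lp.memLp w₂)
  -- Bounding the product of the two functions by the sum of their squares leaves integrals in `s`
  -- that do not depend on the translation.
  have hle : ∀ (q : ((Fin k → ℝ) × (Fin d → ℝ)) × (Fin d → ℝ)) (s : Fin d → ℝ),
      ‖f q * ech (pairing (lam, s ᵥ* matB v lam) q.1) * w₁ (s - q.2) * conj (w₂ s)‖
        ≤ ‖f q‖ * (‖w₁ (s - q.2)‖ ^ 2 + ‖w₂ s‖ ^ 2) := by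
    intro q s
    simp only [norm_mul, RCLike.norm_conj, norm_ech, mul_assoc, one_mul]
    refine mul_le_mul_of_nonneg_left ?_ (norm_nonneg _)
    nlinarith [sq_nonneg (‖w₁ (s - q.2)‖ - ‖w₂ s‖), sq_nonneg ‖w₁ (s - q.2)‖, sq_nonneg ‖w₂ s‖]
  have hb : ∀ q : ((Fin k → ℝ) × (Fin d → ℝ)) × (Fin d → ℝ),
      Integrable fun s => ‖f q‖ * (‖w₁ (s - q.2)‖ ^ 2 + ‖w₂ s‖ ^ 2) := fun q =>
    ((hsq₁ q.2).add hsq₂).const_mul _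
  refine (integrable_prod_iff hm.aestronglyMeasurable).2 ⟨Eventually.of_forall fun q => ?_, ?_⟩
  · exact (hb q).mono' (hm.comp measurable_prodMk_left).aestronglyMeasurable
      (Eventually.of_forall fun s => hle q s)
  · refine (hf.norm.mul_const ((∫ s, ‖w₁ s‖ ^ 2) + ∫ s, ‖w₂ s‖ ^ 2)).mono'
      hm.norm.stronglyMeasurable.integral_prod_right'.aestronglyMeasurable
      (Eventually.of_forall fun q => ?_)
    rw [Real.norm_of_nonneg (integral_nonneg fun _ => norm_nonneg _)]
    refine (integral_mono_of_nonneg (Eventually.of_forall fun _ => norm_nonneg _) (hb q)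
      (Eventually.of_forall fun s => hle q s)).trans_eq ?_
    rw [integral_const_mul, integral_add (hsq₁ q.2) hsq₂,
      integral_sub_right_eq_self (fun s => ‖w₁ s‖ ^ 2)]

/-- The substitution `x = s - t`, which turns a matrix coefficient into an integral against a kernel
in `(s, t)`. -/
theorem measurePreserving_shear : MeasurePreserving
    (fun r : ((Fin d → ℝ) × (Fin d → ℝ)) × ((Fin k → ℝ) × (Fin d → ℝ)) =>
      ((r.2, r.1.1 - r.1.2), r.1.1)) volume volume := by
  have h1 : MeasurePreserving (fun r : (Fin d → ℝ) × (Fin d → ℝ) => (r.1 - r.2, r.1))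
      volume volume := by
    have h2 : MeasurePreserving (fun r : (Fin d → ℝ) × (Fin d → ℝ) => (r.1, r.1 - r.2))
        (volume.prod volume) (volume.prod volume) :=
      (MeasurePreserving.id volume).skew_product (g := fun s t => s - t)
        (measurable_fst.sub measurable_snd)
        (Eventually.of_forall fun s => (Measure.measurePreserving_sub_left volume s).map_eq)
    exact Measure.measurePreserving_swap.comp h2
  have h3 : MeasurePreserving (Prod.swap : ((Fin d → ℝ) × (Fin d → ℝ)) ×
      ((Fin k → ℝ) × (Fin d → ℝ)) → _) volume volume := Measure.measurePreserving_swap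
  exact (volume_preserving_prodAssoc.symm.comp ((MeasurePreserving.id volume).prod h1)).comp h3

/-- Fubini and the substitution `x = s - t` exhibit `pft f (psi (λ, s, t))` as the kernel of `∫ f(n)
π_λ(n) dn`. The identity holds for every `λ`, singular ones included. -/
theorem integral_mul_inner_rep {f : ((Fin k → ℝ) × (Fin d → ℝ)) × (Fin d → ℝ) → ℂ}
    (hfm : Measurable f) (hf : Integrable f) (lam : Fin k → ℝ) (w₁ w₂ : L2R d) :
    Integrable (fun p : (Fin d → ℝ) × (Fin d → ℝ) =>
      pft f (psi v (lam, p)) * w₁ p.2 * conj (w₂ p.1)) ∧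
    ∫ n : Grp v, f (coords v n) * inner ℂ w₂ (rep v lam n w₁)
      = ∫ p : (Fin d → ℝ) × (Fin d → ℝ), pft f (psi v (lam, p)) * w₁ p.2 * conj (w₂ p.1) := by
  have hJ0 := integrable_matrixCoeff v hfm hf lam w₁ w₂
  have hJ := (measurePreserving_shear (k := k) (d := d)).integrable_comp_of_integrable hJ0
  have hslice : ∀ p : (Fin d → ℝ) × (Fin d → ℝ),
      ∫ q, f (q, p.1 - p.2) * ech (pairing (lam, p.1 ᵥ* matB v lam) q) * w₁ (p.1 - (p.1 - p.2))
        * conj (w₂ p.1) = pft f (psi v (lam, p)) * w₁ p.2 * conj (w₂ p.1) := by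
    intro p
    rw [integral_mul_const, integral_mul_const, sub_sub_cancel]
    rfl
  constructor
  · have h1 := hJ.integral_prod_left
    simpa only [Function.comp_apply, hslice] using h1
  · have h1 : ∫ n : Grp v, f (coords v n) * inner ℂ w₂ (rep v lam n w₁)
        = ∫ n : Grp v, ∫ s, f (coords v n) * ech (pairing (lam, s ᵥ* matB v lam) (coords v n).1)
          * w₁ (s - (coords v n).2) * conj (w₂ s) := by
      refine integral_congr_ae (Eventually.of_forall fun n => ?_)
      simp only
      rw [inner_rep, ← integral_const_mul]
      refine integral_congr_ae (Eventually.of_forall fun s => ?_)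
      simp only [coords, mul_assoc]
    have h2 : Integrable (fun r : ((Fin d → ℝ) × (Fin d → ℝ)) × ((Fin k → ℝ) × (Fin d → ℝ)) =>
        f (r.2, r.1.1 - r.1.2) * ech (pairing (lam, r.1.1 ᵥ* matB v lam) r.2) *
          w₁ (r.1.1 - (r.1.1 - r.1.2)) * conj (w₂ r.1.1)) (volume.prod volume) := hJ
    rw [h1, integral_coords v (fun q => ∫ s, f q * ech (pairing (lam, s ᵥ* matB v lam) q.1)
      * w₁ (s - q.2) * conj (w₂ s))]
    rw [← integral_prod _ hJ0, ← Measure.volume_eq_prod,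
      ← (measurePreserving_shear (k := k) (d := d)).map_eq, integral_map
      measurePreserving_shear.measurable.aemeasurable
      (by rw [measurePreserving_shear.map_eq]; exact hJ0.aestronglyMeasurable)]
    refine (integral_prod _ h2).trans ?_
    simp only [hslice]

end TwoStep

/-! ### The Fourier transform on `N` as a partial Fourier transform -/

namespace TwoStep

open scoped Matrix

variable {𝔫 : Type*} [LieRing 𝔫] [LieAlgebra ℝ 𝔫] {k d : ℕ} (v : Basis (Idx k d) ℝ 𝔫)

/-- The inverse of the coordinate map `coords`. -/
def uncoords (q : ((Fin k → ℝ) × (Fin d → ℝ)) × (Fin d → ℝ)) : Grp v := (q.1.1, q.1.2, q.2)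

theorem measurePreserving_uncoords : MeasurePreserving (uncoords v) volume volume :=
  volume_preserving_prodAssoc

variable {v}

theorem measurable_comp_uncoords (f : L2N v) : Measurable (f ∘ uncoords v) :=
  (Lp.stronglyMeasurable f).measurable.comp (measurePreserving_uncoords v).measurable

theorem integrable_comp_uncoords {f : Grp v → ℂ} (hf : Integrable f) :
    Integrable (f ∘ uncoords v) :=
  (measurePreserving_uncoords v).integrable_comp_of_integrable hf

theorem measurable_direct (K : DirectInt v) : Measurable K := (Lp.stronglyMeasurable K).measurable

theorem setIntegral_prod_eq_indicatorConstLp {A B : Set (Fin d → ℝ)} (hA : MeasurableSet A)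
    (hB : MeasurableSet B) (hA' : volume A ≠ ⊤) (hB' : volume B ≠ ⊤)
    (h : (Fin d → ℝ) × (Fin d → ℝ) → ℂ) :
    (fun p : (Fin d → ℝ) × (Fin d → ℝ) => h p * (indicatorConstLp 2 hB hB' (1 : ℂ) : L2R d) p.2
      * conj ((indicatorConstLp 2 hA hA' (1 : ℂ) : L2R d) p.1)) =ᵐ[volume]
      (A ×ˢ B).indicator h := by
  have h1 := (Measure.quasiMeasurePreserving_fst (μ := (volume : Measure (Fin d → ℝ)))
    (ν := (volume : Measure (Fin d → ℝ)))).ae (indicatorConstLp_coeFn (p := 2) (hs := hA)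
      (hμs := hA') (c := (1 : ℂ)))
  have h2 := (Measure.quasiMeasurePreserving_snd (μ := (volume : Measure (Fin d → ℝ)))
    (ν := (volume : Measure (Fin d → ℝ)))).ae (indicatorConstLp_coeFn (p := 2) (hs := hB)
      (hμs := hB') (c := (1 : ℂ)))
  filter_upwards [h1, h2] with p hp1 hp2
  rw [hp1, hp2]
  by_cases h3 : p.1 ∈ A <;> by_cases h4 : p.2 ∈ B <;> simp [h3, h4, Set.indicator]

/-- The Fourier transform of `f` is given by the partial Fourier transform of `f`. -/
theorem isFourierTransform_iff (f : L2N v) (K : DirectInt v) :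
    IsFourierTransform v f K ↔ Integrable f volume ∧
      K =ᵐ[(plancherelMeasure v).prod volume] fun p => pft (f ∘ uncoords v) (psi v p) := by
  refine and_congr_right fun hf => ?_
  have hfm := measurable_comp_uncoords f
  have hfi := integrable_comp_uncoords hf
  have key : ∀ lam w₁ w₂, ∫ n : Grp v, f n * inner ℂ w₂ (rep v lam n w₁) =
      ∫ p : (Fin d → ℝ) × (Fin d → ℝ), pft (f ∘ uncoords v) (psi v (lam, p)) * w₁ p.2 *
        conj (w₂ p.1) := fun lam w₁ w₂ => (integral_mul_inner_rep v hfm hfi lam w₁ w₂).2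
  have hGm : Measurable fun p => pft (f ∘ uncoords v) (psi v p) :=
    (measurable_pft hfm).comp (measurable_psi v)
  simp only [key]
  constructor
  · intro h
    refine (Measure.ae_prod_iff_ae_ae (p := fun p => K p = pft (f ∘ uncoords v) (psi v p))
      (measurableSet_eq_fun (measurable_direct K) hGm)).2 ?_
    have hK2 := ((memLp_two_iff_integrable_sq_norm (Lp.memLp K).1).1 (Lp.memLp K)).prod_right_ae
    filter_upwards [h, hK2] with lam hlam hK
    have hKm : Measurable fun p : (Fin d → ℝ) × (Fin d → ℝ) => K (lam, p) :=
      (measurable_direct K).comp measurable_prodMk_left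
    have hKL : MemLp (fun p : (Fin d → ℝ) × (Fin d → ℝ) => K (lam, p)) 2 :=
      (memLp_two_iff_integrable_sq_norm hKm.aestronglyMeasurable).2 hK
    have hi1 : ∀ A B : Set (Fin d → ℝ), MeasurableSet A → MeasurableSet B → volume A < ⊤ →
        volume B < ⊤ → IntegrableOn (fun p => K (lam, p)) (A ×ˢ B) (volume.prod volume) := by
      intro A B hA hB hA' hB'
      have : IsFiniteMeasure ((volume.prod volume : Measure ((Fin d → ℝ) × (Fin d → ℝ))).restrict
          (A ×ˢ B)) := ⟨by simpa [Measure.prod_prod] using ENNReal.mul_lt_top hA' hB'⟩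
      exact (hKL.restrict _).integrable one_le_two
    -- This kernel slice is not known to be square-integrable; integrability on rectangles is read
    -- off from matrix coefficients of indicator functions.
    have hi2 : ∀ A B : Set (Fin d → ℝ), MeasurableSet A → MeasurableSet B → volume A < ⊤ →
        volume B < ⊤ → IntegrableOn (fun p => pft (f ∘ uncoords v) (psi v (lam, p))) (A ×ˢ B)
          (volume.prod volume) := by
      intro A B hA hB hA' hB'
      have h1 := (integral_mul_inner_rep v hfm hfi lam (indicatorConstLp 2 hB hB'.ne (1 : ℂ))
        (indicatorConstLp 2 hA hA'.ne (1 : ℂ))).1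
      exact (integrable_indicator_iff (hA.prod hB)).1
        (h1.congr (setIntegral_prod_eq_indicatorConstLp hA hB hA'.ne hB'.ne _))
    have h0 := ae_eq_zero_of_setIntegral_prod (μ := (volume : Measure (Fin d → ℝ)))
      (ν := (volume : Measure (Fin d → ℝ)))
      (h := fun p => K (lam, p) - pft (f ∘ uncoords v) (psi v (lam, p)))
      (fun A B hA hB hA' hB' => (hi1 A B hA hB hA' hB').sub (hi2 A B hA hB hA' hB'))
      (fun A B hA hB hA' hB' => ?_)
    · filter_upwards [h0] with p hp using sub_eq_zero.1 hp
    · rw [integral_sub (hi1 A B hA hB hA' hB') (hi2 A B hA hB hA' hB'), sub_eq_zero]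
      -- Testing the weak identity on indicator functions compares the two kernels over the
      -- rectangle `A × B`.
      have h1 := hlam (indicatorConstLp 2 hB hB'.ne (1 : ℂ)) (indicatorConstLp 2 hA hA'.ne (1 : ℂ))
      rw [integral_congr_ae (setIntegral_prod_eq_indicatorConstLp hA hB hA'.ne hB'.ne _),
        integral_congr_ae (setIntegral_prod_eq_indicatorConstLp hA hB hA'.ne hB'.ne _),
        integral_indicator (hA.prod hB), integral_indicator (hA.prod hB)] at h1
      exact h1.symm
  · intro h
    filter_upwards [Measure.ae_ae_of_ae_prod h] with lam hlam w₁ w₂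
    refine integral_congr_ae ?_
    filter_upwards [hlam] with p hp
    rw [hp]

end TwoStep

namespace TwoStep

open scoped Matrix

/-! ### Unitary operators defined on total families -/

/-- Equal Gram matrices give corresponding finite linear combinations equal norms, so the
correspondence extends to the closures, which are the whole spaces. -/
theorem exists_unitary_of_gram {E F ι : Type*} [NormedAddCommGroup E] [InnerProductSpace ℂ E]
    [CompleteSpace E] [NormedAddCommGroup F] [InnerProductSpace ℂ F] [CompleteSpace F]
    {a : ι → E} {b : ι → F} (hab : ∀ i j, inner ℂ (b i) (b j) = inner ℂ (a i) (a j))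
    (ha : Dense (Submodule.span ℂ (Set.range a) : Set E))
    (hb : Dense (Submodule.span ℂ (Set.range b) : Set F)) :
    ∃ U : E ≃ₗᵢ[ℂ] F, ∀ i, U (a i) = b i := by
  have hda : DenseRange (Finsupp.linearCombination ℂ a) := by
    rw [DenseRange, ← LinearMap.coe_range, Finsupp.range_linearCombination]
    exact ha
  have hdb : DenseRange (Finsupp.linearCombination ℂ b) := by
    rw [DenseRange, ← LinearMap.coe_range, Finsupp.range_linearCombination]
    exact hb
  have hn : ∀ x : ι →₀ ℂ, ‖Finsupp.linearCombination ℂ b (LinearEquiv.refl ℂ (ι →₀ ℂ) x)‖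
      = ‖Finsupp.linearCombination ℂ a x‖ := by
    intro x
    rw [LinearEquiv.refl_apply, @norm_eq_sqrt_re_inner ℂ, @norm_eq_sqrt_re_inner ℂ]
    simp only [Finsupp.linearCombination_apply, Finsupp.sum_inner, Finsupp.inner_sum,
      inner_smul_left, inner_smul_right, hab]
  refine ⟨(LinearEquiv.refl ℂ (ι →₀ ℂ)).extendOfIsometry _ _ hda hdb hn, fun i => ?_⟩
  have h := LinearEquiv.extendOfIsometry_eq (LinearEquiv.refl ℂ (ι →₀ ℂ)) _ _ hda hdb hn
    (Finsupp.single i 1)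
  simpa using h

theorem dense_span_of_orthogonal {E ι : Type*} [NormedAddCommGroup E] [InnerProductSpace ℂ E]
    [CompleteSpace E] {a : ι → E} (h : ∀ x, (∀ i, inner ℂ (a i) x = 0) → x = 0) :
    Dense (Submodule.span ℂ (Set.range a) : Set E) := by
  rw [Submodule.dense_iff_topologicalClosure_eq_top, Submodule.topologicalClosure_eq_top_iff,
    Submodule.eq_bot_iff]
  intro x hx
  exact h x fun i => (Submodule.mem_orthogonal _ _).1 hx _ (Submodule.subset_span ⟨i, rfl⟩)

variable {𝔫 : Type*} [LieRing 𝔫] [LieAlgebra ℝ 𝔫] {k d : ℕ} {v : Basis (Idx k d) ℝ 𝔫}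

/-! ### Test functions for the Plancherel transform -/

/-- A Fourier pair on `ℝᵏ × ℝᵈ` together with a subset of `ℝᵈ` of finite measure. -/
structure TestData (k d : ℕ) where
  /-- the function on the Fourier side -/
  g : (Fin k → ℝ) × (Fin d → ℝ) → ℂ
  /-- the function on the group side -/
  φ : (Fin k → ℝ) × (Fin d → ℝ) → ℂ
  /-- the set of finite measure -/
  A : Set (Fin d → ℝ)
  isFourierPair : IsFourierPair g φ
  measurableSet : MeasurableSet A
  finite : volume A ≠ ⊤

theorem TestData.memLp_left (τ : TestData k d) :
    MemLp (fun q : ((Fin k → ℝ) × (Fin d → ℝ)) × (Fin d → ℝ) => τ.g q.1 * τ.A.indicator 1 q.2) 2 :=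
  memLp_two_mul_prod τ.isFourierPair.memLp_left
    (memLp_indicator_const 2 τ.measurableSet (1 : ℂ) (Or.inr τ.finite))

theorem TestData.memLp_right (τ : TestData k d) :
    MemLp (fun q : ((Fin k → ℝ) × (Fin d → ℝ)) × (Fin d → ℝ) => τ.φ q.1 * τ.A.indicator 1 q.2) 2 :=
  memLp_two_mul_prod τ.isFourierPair.memLp_right
    (memLp_indicator_const 2 τ.measurableSet (1 : ℂ) (Or.inr τ.finite))

/-- The element of `L²(N)` defined by a test datum. -/
def TestData.toGrp (v : Basis (Idx k d) ℝ 𝔫) (τ : TestData k d) : L2N v :=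
  (τ.memLp_right.comp_measurePreserving (measurePreserving_coords v)).toLp _

/-- The element of the direct integral defined by a test datum. -/
def TestData.toDirect (hv : IsAdapted v) (τ : TestData k d) : DirectInt v :=
  (τ.memLp_left.comp_measurePreserving hv.measurePreserving_psi).toLp _

theorem TestData.coeFn_toGrp (τ : TestData k d) :
    (τ.toGrp v : Grp v → ℂ) =ᵐ[volume]
      fun n => τ.φ (coords v n).1 * τ.A.indicator 1 (coords v n).2 :=
  MemLp.coeFn_toLp _

theorem TestData.coeFn_toDirect (hv : IsAdapted v) (τ : TestData k d) :
    (τ.toDirect hv : _ → ℂ) =ᵐ[(plancherelMeasure v).prod volume]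
      fun p => τ.g (psi v p).1 * τ.A.indicator 1 (psi v p).2 :=
  MemLp.coeFn_toLp _

theorem TestData.toGrp_comp_uncoords (τ : TestData k d) :
    τ.toGrp v ∘ uncoords v =ᵐ[volume] fun q => τ.φ q.1 * τ.A.indicator 1 q.2 :=
  (measurePreserving_uncoords v).quasiMeasurePreserving.ae τ.coeFn_toGrp

theorem TestData.isFourierTransform (hv : IsAdapted v) (τ : TestData k d) :
    IsFourierTransform v (τ.toGrp v) (τ.toDirect hv) := by
  rw [isFourierTransform_iff]
  constructor
  · have h1 : Integrable (fun q : ((Fin k → ℝ) × (Fin d → ℝ)) × (Fin d → ℝ) =>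
        τ.φ q.1 * τ.A.indicator 1 q.2) :=
      τ.isFourierPair.integrable_right.mul_prod
        ((integrable_indicator_iff τ.measurableSet).2 (integrableOn_const τ.finite))
    exact ((measurePreserving_coords v).integrable_comp_of_integrable h1).congr τ.coeFn_toGrp.symm
  · have h1 := pft_congr_ae (ν := volume) (τ.toGrp_comp_uncoords (v := v))
    have h2 := hv.measurePreserving_psi.quasiMeasurePreserving.ae h1
    filter_upwards [τ.coeFn_toDirect hv, h2] with p hp hp2
    rw [hp, hp2, pft_mul_indicator τ.isFourierPair]

theorem integral_comp_psi (hv : IsAdapted v) {F : ((Fin k → ℝ) × (Fin d → ℝ)) × (Fin d → ℝ) → ℂ}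
    (hF : AEStronglyMeasurable F volume) :
    ∫ p, F (psi v p) ∂((plancherelMeasure v).prod volume) = ∫ q, F q := by
  rw [← hv.measurePreserving_psi.map_eq, integral_map
    hv.measurePreserving_psi.measurable.aemeasurable
    (by rw [hv.measurePreserving_psi.map_eq]; exact hF)]

theorem TestData.inner_toGrp (τ : TestData k d) (f : L2N v) :
    inner ℂ (τ.toGrp v) f = ∫ q, conj (τ.φ q.1 * τ.A.indicator 1 q.2) * (f ∘ uncoords v) q := by
  rw [L2.inner_def, ← integral_coords v]
  refine integral_congr_ae ?_
  filter_upwards [τ.coeFn_toGrp] with n hn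
  rw [RCLike.inner_apply, hn, mul_comm]
  rfl

theorem TestData.inner_toDirect (hv : IsAdapted v) (τ : TestData k d) {K : DirectInt v}
    {G : ((Fin k → ℝ) × (Fin d → ℝ)) × (Fin d → ℝ) → ℂ} (hG : Measurable G)
    (hK : K =ᵐ[(plancherelMeasure v).prod volume] fun p => G (psi v p)) :
    inner ℂ (τ.toDirect hv) K = ∫ q, conj (τ.g q.1 * τ.A.indicator 1 q.2) * G q := by
  have hm : AEStronglyMeasurable (fun q : ((Fin k → ℝ) × (Fin d → ℝ)) × (Fin d → ℝ) =>
      conj (τ.g q.1 * τ.A.indicator 1 q.2) * G q) volume :=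
    (Complex.continuous_conj.comp_aestronglyMeasurable τ.memLp_left.1).mul
      hG.aestronglyMeasurable
  rw [L2.inner_def, ← integral_comp_psi hv hm]
  refine integral_congr_ae ?_
  filter_upwards [τ.coeFn_toDirect hv, hK] with p hp hp2
  rw [RCLike.inner_apply, hp, hp2, mul_comm]

/-- Parseval's identity against a test function, for any integrable `f` in `L²(N)`. It provides both
the equality of Gram matrices and the uniqueness of the transform. -/
theorem TestData.inner_eq (hv : IsAdapted v) (τ : TestData k d) {f : L2N v} {K : DirectInt v}
    (h : IsFourierTransform v f K) : inner ℂ (τ.toDirect hv) K = inner ℂ (τ.toGrp v) f := by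
  obtain ⟨hf, hK⟩ := (isFourierTransform_iff f K).1 h
  have hfm := measurable_comp_uncoords f
  rw [τ.inner_toDirect hv (measurable_pft hfm) hK, τ.inner_toGrp]
  refine integral_conj_mul_pft (ν := volume) τ.isFourierPair hfm (integrable_comp_uncoords hf)
    (a := τ.A.indicator 1) (measurable_one.indicator τ.measurableSet) fun x => ?_
  by_cases hx : x ∈ τ.A <;> simp [hx]

/-- Here the smooth function is prescribed as `φ`, on the group side. -/
theorem eq_zero_of_inner_toGrp {f : L2N v} (h : ∀ τ : TestData k d, inner ℂ (τ.toGrp v) f = 0) :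
    f = 0 := by
  have hL : MemLp (f ∘ uncoords v) 2 volume :=
    (Lp.memLp f).comp_measurePreserving (measurePreserving_uncoords v)
  have h0 := ae_eq_zero_of_test (μ := volume) (ν := volume) hL fun ψ hψ hc A hA hA' => ?_
  · rw [Lp.eq_zero_iff_ae_eq_zero]
    exact (measurePreserving_coords v).quasiMeasurePreserving.ae h0
  · obtain ⟨g, hg⟩ := exists_isFourierPair_right hψ hc
    have h1 := h ⟨g, _, A, hg, hA, hA'.ne⟩
    rw [TestData.inner_toGrp] at h1
    rw [← h1]
    refine integral_congr_ae (Eventually.of_forall fun q => ?_)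
    by_cases hq : q.2 ∈ A <;> simp [hq]

/-- Composition with `psiInv` moves the question to Lebesgue measure; the smooth function is
prescribed as `g`, on the Fourier side. -/
theorem eq_zero_of_inner_toDirect (hv : IsAdapted v) {K : DirectInt v}
    (h : ∀ τ : TestData k d, inner ℂ (τ.toDirect hv) K = 0) : K = 0 := by
  have hL : MemLp (K ∘ psiInv v) 2 volume :=
    (Lp.memLp K).comp_measurePreserving hv.measurePreserving_psiInv
  have hK : K =ᵐ[(plancherelMeasure v).prod volume] fun p => (K ∘ psiInv v) (psi v p) := by
    have h1 := (Measure.quasiMeasurePreserving_fst (μ := plancherelMeasure v)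
      (ν := (volume : Measure ((Fin d → ℝ) × (Fin d → ℝ))))).ae
      (ae_plancherel_det_ne_zero (v := v))
    filter_upwards [h1] with p hp
    rw [Function.comp_apply, psiInv_psi v hp]
  have h0 := ae_eq_zero_of_test (μ := volume) (ν := volume) hL fun ψ hψ hc A hA hA' => ?_
  · rw [Lp.eq_zero_iff_ae_eq_zero]
    filter_upwards [hK, hv.measurePreserving_psi.quasiMeasurePreserving.ae h0] with p hp hp2
    rw [hp, hp2]
    rfl
  · obtain ⟨φ, hφ⟩ := exists_isFourierPair hψ hc
    have h1 := h ⟨_, φ, A, hφ, hA, hA'.ne⟩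
    rw [TestData.inner_toDirect hv _ ((measurable_direct K).comp (measurable_psiInv v)) hK] at h1
    rw [← h1]
    refine integral_congr_ae (Eventually.of_forall fun q => ?_)
    by_cases hq : q.2 ∈ A <;> simp [hq]

/-! ### The Plancherel theorem -/

theorem isFourierTransform_zero (hv : IsAdapted v) : IsFourierTransform v 0 0 := by
  rw [isFourierTransform_iff]
  have h0 : ((0 : L2N v) : Grp v → ℂ) =ᵐ[volume] fun _ => 0 := Lp.coeFn_zero _ _ _
  have h1 := pft_congr_ae (ν := volume)
    ((measurePreserving_uncoords v).quasiMeasurePreserving.ae h0)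
  refine ⟨(integrable_zero _ _ _).congr h0.symm, ?_⟩
  filter_upwards [hv.measurePreserving_psi.quasiMeasurePreserving.ae h1,
    Lp.coeFn_zero ℂ 2 ((plancherelMeasure v).prod volume)] with p h3 h4
  rw [h4]
  refine Eq.trans ?_ h3.symm
  simp [pft]

theorem IsFourierTransform.add_smul (hv : IsAdapted v) {f g : L2N v} {K L : DirectInt v} (c : ℂ)
    (hf : IsFourierTransform v f K) (hg : IsFourierTransform v g L) :
    IsFourierTransform v (f + c • g) (K + c • L) := by
  rw [isFourierTransform_iff] at hf hg ⊢
  have hfg : (f + c • g : L2N v) =ᵐ[volume] fun n => f n + c * g n := by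
    filter_upwards [Lp.coeFn_add f (c • g), Lp.coeFn_smul c g] with n h1 h2
    rw [h1, Pi.add_apply, h2, Pi.smul_apply, smul_eq_mul]
  have h1 := pft_congr_ae (ν := volume)
    ((measurePreserving_uncoords v).quasiMeasurePreserving.ae hfg)
  have h2 := pft_add_smul (ν := volume) c (integrable_comp_uncoords hf.1)
    (integrable_comp_uncoords hg.1)
  refine ⟨(hf.1.add (hg.1.const_mul c)).congr hfg.symm, ?_⟩
  filter_upwards [hv.measurePreserving_psi.quasiMeasurePreserving.ae h1,
    hv.measurePreserving_psi.quasiMeasurePreserving.ae h2, hf.2, hg.2, Lp.coeFn_add K (c • L),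
    Lp.coeFn_smul c L] with p h3 h4 h5 h6 h7 h8
  rw [h7, Pi.add_apply, h8, Pi.smul_apply, smul_eq_mul, h5, h6]
  exact (h3.trans h4).symm

/-- The Plancherel transform is the graph of a unitary operator. -/
theorem exists_plancherel (hv : IsAdapted v) :
    ∃ U : L2N v ≃ₗᵢ[ℂ] DirectInt v, ∀ f K, IsPlancherelTransform v f K ↔ K = U f := by
  have hgram : ∀ τ τ' : TestData k d, inner ℂ (τ.toDirect hv) (τ'.toDirect hv)
      = inner ℂ (τ.toGrp v) (τ'.toGrp v) := fun τ τ' => τ.inner_eq hv (τ'.isFourierTransform hv)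
  have hd := dense_span_of_orthogonal fun (f : L2N v) => eq_zero_of_inner_toGrp (f := f)
  obtain ⟨U, hU⟩ := exists_unitary_of_gram hgram hd
    (dense_span_of_orthogonal fun K => eq_zero_of_inner_toDirect hv)
  -- A Fourier transform of `f` has the same inner products with the test functions as `U f`, and
  -- these are total.
  have hFT : ∀ f K, IsFourierTransform v f K → K = U f := by
    intro f K h
    rw [← sub_eq_zero]
    refine eq_zero_of_inner_toDirect hv fun τ => ?_
    rw [inner_sub_right, τ.inner_eq hv h, ← hU, U.inner_map_map, sub_self]
  have hspan : ∀ f ∈ Submodule.span ℂ (Set.range fun τ : TestData k d => τ.toGrp v),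
      IsFourierTransform v f (U f) := by
    intro f hf
    induction hf using Submodule.span_induction with
    | mem f hf =>
      obtain ⟨τ, rfl⟩ := hf
      simp only [hU]
      exact τ.isFourierTransform hv
    | zero => simpa using isFourierTransform_zero hv
    | add f g _ _ hf hg => simpa using hf.add_smul hv 1 hg
    | smul c f _ hf => simpa using (isFourierTransform_zero hv).add_smul hv c hf
  -- One inclusion holds because the graph of `U` is closed and contains all Fourier transforms. The
  -- other holds because the span of the test functions is dense and `U` is continuous.
  refine ⟨U, fun f K => ⟨fun h => ?_, ?_⟩⟩
  · have hcl : IsClosed {p : L2N v × DirectInt v | p.2 = U p.1} :=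
      isClosed_eq continuous_snd (U.continuous.comp continuous_fst)
    exact closure_minimal (fun p hp => hFT p.1 p.2 hp) hcl h
  · rintro rfl
    have hcl : IsClosed {f : L2N v | IsPlancherelTransform v f (U f)} :=
      isClosed_closure.preimage (continuous_id.prodMk U.continuous)
    have hsub : (Submodule.span ℂ (Set.range fun τ : TestData k d => τ.toGrp v) : Set (L2N v))
        ⊆ {f : L2N v | IsPlancherelTransform v f (U f)} := fun g hg => by
      have h1 : (g, U g) ∈ {p : L2N v × DirectInt v | IsFourierTransform v p.1 p.2} := hspan g hg
      exact subset_closure h1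
    exact closure_minimal hsub hcl (hd f)

end TwoStep

namespace TwoStep

open scoped Matrix

variable {𝔫 : Type*} [LieRing 𝔫] [LieAlgebra ℝ 𝔫] {k d : ℕ} (v : Basis (Idx k d) ℝ 𝔫)

/-! ### The Plancherel transform intertwines left translation with `π_λ` -/

theorem continuous_lieXY_right (x : Fin d → ℝ) : Continuous fun y : Fin d → ℝ => lieXY v x y := by
  have : (fun y : Fin d → ℝ => lieXY v x y)
      = fun y l => ∑ j, y j * v.repr ⁅xVec v x, Yb v j⁆ (Sum.inl l) := by
    funext y l
    simp only [lieXY, yVec, lie_sum, lie_smul, map_sum, map_smul, Finsupp.coe_finsetSum,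
      Finset.sum_apply, Finsupp.smul_apply, smul_eq_mul]
  rw [this]
  fun_prop

theorem measurePreserving_affine (γ : Grp v) : MeasurePreserving
    (fun p : (Fin k → ℝ) × (Fin d → ℝ) => (γ.1 + p.1 + lieXY v γ.2.2 p.2, γ.2.1 + p.2))
    volume volume := by
  have h1 : MeasurePreserving
      (fun p : (Fin d → ℝ) × (Fin k → ℝ) => (γ.2.1 + p.1, γ.1 + p.2 + lieXY v γ.2.2 p.1))
      (volume.prod volume) (volume.prod volume) := by
    refine (measurePreserving_add_left volume γ.2.1).skew_product
      (g := fun y z => γ.1 + z + lieXY v γ.2.2 y) ?_ (Eventually.of_forall fun y => ?_)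
    · exact Continuous.measurable ((continuous_const.add continuous_snd).add
        ((continuous_lieXY_right v _).comp continuous_fst))
    · have h2 : (fun z : Fin k → ℝ => γ.1 + z + lieXY v γ.2.2 y)
          = fun z => γ.1 + lieXY v γ.2.2 y + z := by
        funext z
        abel
      rw [h2]
      exact (measurePreserving_add_left volume _).map_eq
  exact (Measure.measurePreserving_swap.comp h1).comp Measure.measurePreserving_swap

/-- Substitute left multiplication by `γ` in `(z, y)`. The commutator term `λ[x, y]`, with `x` the
`X`-coordinate of `γ`, then shifts the frequency `ξ` by `x B(λ)`. -/
theorem pft_leftTranslate {f : Grp v → ℂ} (hf : Measurable f) (γ : Grp v) (lam : Fin k → ℝ)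
    (ξ x : Fin d → ℝ) :
    pft (fun q => f (γ⁻¹ * uncoords v q)) ((lam, ξ), x) = ech (pairing (lam, ξ) (γ.1, γ.2.1)) *
      pft (f ∘ uncoords v) ((lam, ξ - γ.2.2 ᵥ* matB v lam), x - γ.2.2) := by
  have hmp := measurePreserving_affine v γ
  have hF : Measurable fun p : (Fin k → ℝ) × (Fin d → ℝ) =>
      f (γ⁻¹ * uncoords v (p, x)) * ech (pairing (lam, ξ) p) := by
    refine (hf.comp ((measurePreserving_mul_left v γ⁻¹).measurable.comp
      ((measurePreserving_uncoords v).measurable.comp measurable_prodMk_right))).mul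
      (measurable_ech.comp (continuous_pairing.comp
        (continuous_const.prodMk continuous_id)).measurable)
  simp only [pft]
  rw [← hmp.map_eq, integral_map hmp.measurable.aemeasurable hF.aestronglyMeasurable,
    ← integral_const_mul, hmp.map_eq]
  refine integral_congr_ae (Eventually.of_forall fun p => ?_)
  simp only
  have h1 : uncoords v ((γ.1 + p.1 + lieXY v γ.2.2 p.2, γ.2.1 + p.2), x)
      = γ * uncoords v (p, x - γ.2.2) := by
    refine Prod.ext rfl (Prod.ext rfl ?_)
    exact (add_sub_cancel γ.2.2 x).symm
  have h2 : pairing (lam, ξ) (γ.1 + p.1 + lieXY v γ.2.2 p.2, γ.2.1 + p.2)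
      = pairing (lam, ξ) (γ.1, γ.2.1) + pairing (lam, ξ - γ.2.2 ᵥ* matB v lam) p := by
    simp only [pairing, dotProduct_add, sub_dotProduct, dotProduct_lieXY]
    ring
  rw [h1, inv_mul_cancel_left, h2, ech_add, Function.comp_apply]
  ring

/-- The shift `(λ, s, t) ↦ (λ, s - x, t)`. -/
def shift (x : Fin d → ℝ) (p : (Fin k → ℝ) × (Fin d → ℝ) × (Fin d → ℝ)) :
    (Fin k → ℝ) × (Fin d → ℝ) × (Fin d → ℝ) := (p.1, p.2.1 - x, p.2.2)

theorem measurePreserving_shift (x : Fin d → ℝ) :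
    MeasurePreserving (shift (k := k) x) ((plancherelMeasure v).prod volume)
      ((plancherelMeasure v).prod volume) :=
  (MeasurePreserving.id _).prod ((measurePreserving_sub_right volume x).prod
    (MeasurePreserving.id volume))

/-- The phase of `π_λ(γ)`. -/
def phase (γ : Grp v) (lam : Fin k → ℝ) (s : Fin d → ℝ) : ℂ :=
  ech (pairing (lam, s ᵥ* matB v lam) (γ.1, γ.2.1))

theorem norm_phase (γ : Grp v) (lam : Fin k → ℝ) (s : Fin d → ℝ) : ‖phase v γ lam s‖ = 1 :=
  norm_ech _

theorem measurable_phase (γ : Grp v) :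
    Measurable fun p : (Fin k → ℝ) × (Fin d → ℝ) × (Fin d → ℝ) => phase v γ p.1 p.2.1 := by
  have h1 : Measurable fun p : (Fin k → ℝ) × (Fin d → ℝ) × (Fin d → ℝ) => (psi v p).1 :=
    measurable_fst.comp (measurable_psi v)
  exact measurable_ech.comp (continuous_pairing.measurable.comp (h1.prodMk measurable_const))

theorem memLp_actDirect (γ : Grp v) (K : DirectInt v) :
    MemLp (fun p => phase v γ p.1 p.2.1 * K (shift γ.2.2 p)) 2
      ((plancherelMeasure v).prod volume) := by
  have h1 : MemLp (fun p => K (shift γ.2.2 p)) 2 ((plancherelMeasure v).prod volume) :=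
    (Lp.memLp K).comp_measurePreserving (measurePreserving_shift v γ.2.2)
  refine h1.of_le ((measurable_phase v γ).aestronglyMeasurable.mul h1.1)
    (Eventually.of_forall fun p => ?_)
  rw [norm_mul, norm_phase, one_mul]

/-- The operator `∫^⊕ π_λ(γ) ⊗ 1 dμ(λ)`. -/
def actDirect (γ : Grp v) (K : DirectInt v) : DirectInt v := (memLp_actDirect v γ K).toLp _

theorem coeFn_actDirect (γ : Grp v) (K : DirectInt v) :
    (actDirect v γ K : _ → ℂ) =ᵐ[(plancherelMeasure v).prod volume]
      fun p => phase v γ p.1 p.2.1 * K (shift γ.2.2 p) := MemLp.coeFn_toLp _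

/-- Supplies the continuity needed to extend the intertwining relation from Fourier transforms to
their closure. -/
theorem isometry_actDirect (γ : Grp v) : Isometry (actDirect v γ) := by
  intro K L
  rw [actDirect, actDirect, Lp.edist_toLp_toLp, Lp.edist_def,
    ← eLpNorm_comp_measurePreserving ((Lp.memLp K).1.sub (Lp.memLp L).1)
      (measurePreserving_shift v γ.2.2)]
  refine eLpNorm_congr_norm_ae (Eventually.of_forall fun p => ?_)
  simp only [Pi.sub_apply, Function.comp_apply]
  rw [← mul_sub, norm_mul, norm_phase, one_mul]

variable {v}

/-- Under `psi`, replacing `s` by `s - x` shifts `s B(λ)` by `x B(λ)` and `s - t` by `x`, exactly as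
left translation does. -/
theorem IsFourierTransform.leftReg (hv : IsAdapted v) {f : L2N v} {K : DirectInt v}
    (h : IsFourierTransform v f K) (γ : Grp v) :
    IsFourierTransform v (leftReg v γ f) (actDirect v γ K) := by
  rw [isFourierTransform_iff] at h ⊢
  have hL : (TwoStep.leftReg v γ f : Grp v → ℂ) =ᵐ[volume] fun n => f (γ⁻¹ * n) :=
    Lp.coeFn_compMeasurePreserving f (measurePreserving_mul_left v γ⁻¹)
  constructor
  · exact ((measurePreserving_mul_left v γ⁻¹).integrable_comp_of_integrable h.1).congr hL.symm
  · have h1 := pft_congr_ae (ν := volume)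
      ((measurePreserving_uncoords v).quasiMeasurePreserving.ae hL)
    filter_upwards [hv.measurePreserving_psi.quasiMeasurePreserving.ae h1, coeFn_actDirect v γ K,
      (measurePreserving_shift v γ.2.2).quasiMeasurePreserving.ae h.2] with p h3 h4 h5
    rw [h4, h5]
    refine Eq.trans ?_ h3.symm
    have h6 := pft_leftTranslate v (Lp.stronglyMeasurable f).measurable γ p.1
      (p.2.1 ᵥ* matB v p.1) (p.2.1 - p.2.2)
    rw [← Matrix.sub_vecMul, sub_right_comm] at h6
    exact h6.symm

theorem plancherel_leftReg (hv : IsAdapted v) {U : L2N v ≃ₗᵢ[ℂ] DirectInt v}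
    (hU : ∀ f K, IsPlancherelTransform v f K ↔ K = U f) (γ : Grp v) (f : L2N v) :
    U (leftReg v γ f) = actDirect v γ (U f) := by
  have hcl : IsClosed {p : L2N v × DirectInt v | U (leftReg v γ p.1) = actDirect v γ p.2} :=
    isClosed_eq (U.continuous.comp ((leftReg v γ).continuous.comp continuous_fst))
      ((isometry_actDirect v γ).continuous.comp continuous_snd)
  have hsub : {p : L2N v × DirectInt v | IsFourierTransform v p.1 p.2} ⊆
      {p : L2N v × DirectInt v | U (leftReg v γ p.1) = actDirect v γ p.2} := fun p hp =>
    ((hU _ _).1 (subset_closure (IsFourierTransform.leftReg hv hp γ :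
      (_, _) ∈ {p : L2N v × DirectInt v | IsFourierTransform v p.1 p.2}))).symm
  exact closure_minimal hsub hcl ((hU f (U f)).2 rfl)

end TwoStep

namespace TwoStep

open scoped Matrix

variable {𝔫 : Type*} [LieRing 𝔫] [LieAlgebra ℝ 𝔫] {k d : ℕ} {v : Basis (Idx k d) ℝ 𝔫}

/-! ### Fibres of multiplicity one -/

theorem integral_comp_of_measurePreserving {α β E : Type*} [MeasurableSpace α] [MeasurableSpace β]
    [NormedAddCommGroup E] [NormedSpace ℝ E] {μ : Measure α} {ν : Measure β} {φ : α → β}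
    (hφ : MeasurePreserving φ μ ν) {F : β → E} (hF : AEStronglyMeasurable F ν) :
    ∫ x, F (φ x) ∂μ = ∫ y, F y ∂ν := by
  rw [← hφ.map_eq, integral_map hφ.measurable.aemeasurable (by rw [hφ.map_eq]; exact hF)]

/-- The map `(λ, s) ↦ (λ, s B(λ))`. -/
def phiB (v : Basis (Idx k d) ℝ 𝔫) (p : (Fin k → ℝ) × (Fin d → ℝ)) : (Fin k → ℝ) × (Fin d → ℝ) :=
  (p.1, p.2 ᵥ* matB v p.1)

theorem measurable_phiB : Measurable (phiB v) :=
  measurable_fst.prodMk (continuous_vecMul_matB v).measurable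

theorem IsAdapted.measurePreserving_phiB (hv : IsAdapted v) :
    MeasurePreserving (phiB v) ((plancherelMeasure v).prod volume) volume := by
  refine ⟨measurable_phiB, Measure.ext_of_lintegral _ fun F hF => ?_⟩
  have hd : Measurable fun lam => ENNReal.ofReal |(matB v lam).det| :=
    (continuous_det_matB v).abs.measurable.ennreal_ofReal
  have hFp : Measurable fun p => F (phiB v p) := hF.comp measurable_phiB
  rw [lintegral_map hF measurable_phiB, lintegral_prod _ hFp.aemeasurable, plancherelMeasure,
    lintegral_withDensity_eq_lintegral_mul _ hd hFp.lintegral_prod_right',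
    Measure.volume_eq_prod (Fin k → ℝ), lintegral_prod _ hF.aemeasurable]
  refine lintegral_congr_ae ?_
  filter_upwards [hv.ae_det_ne_zero] with lam hlam
  exact lintegral_vecMul hlam (hF.comp measurable_prodMk_left)

theorem phiB_eq (lam : Fin k → ℝ) (ξ : Fin d → ℝ) (h : (matB v lam).det ≠ 0) :
    phiB v (lam, ξ ᵥ* (matB v lam)⁻¹) = (lam, ξ) := by
  simp [phiB, Matrix.vecMul_vecMul, Matrix.nonsing_inv_mul _ (Ne.isUnit h)]

/-- The coefficient `⟨K(λ, s, ·), conj u(λ)⟩`. -/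
def fiberCoeff (u : (Fin k → ℝ) → (Fin d → ℝ) → ℂ) (K : DirectInt v)
    (p : (Fin k → ℝ) × (Fin d → ℝ)) : ℂ := ∫ t, K (p.1, p.2, t) * u p.1 t

theorem measurable_fiberCoeff {u : (Fin k → ℝ) → (Fin d → ℝ) → ℂ}
    (hu : Measurable (Function.uncurry u)) (K : DirectInt v) : Measurable (fiberCoeff u K) := by
  have h : Measurable fun r : ((Fin k → ℝ) × (Fin d → ℝ)) × (Fin d → ℝ) =>
      K (r.1.1, r.1.2, r.2) * u r.1.1 r.2 :=
    ((measurable_direct K).comp MeasurableEquiv.prodAssoc.measurable).mul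
      (hu.comp ((measurable_fst.comp measurable_fst).prodMk measurable_snd))
  exact h.stronglyMeasurable.integral_prod_right'.measurable

theorem integral_norm_sq_eq_one {f : (Fin d → ℝ) → ℂ} (hf : Measurable f)
    (h : eLpNorm f 2 volume = 1) : ∫ t, ‖f t‖ ^ 2 = 1 := by
  have hm : MemLp f 2 := ⟨hf.aestronglyMeasurable, by rw [h]; exact ENNReal.one_lt_top⟩
  have h1 := hm.eLpNorm_eq_integral_rpow_norm two_ne_zero ENNReal.ofNat_ne_top
  rw [h] at h1
  have h0 : 0 ≤ ∫ t, ‖f t‖ ^ (2 : ENNReal).toReal := integral_nonneg fun t => by positivity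
  have h2 : (∫ t, ‖f t‖ ^ (2 : ENNReal).toReal) ^ (2 : ENNReal).toReal⁻¹ = 1 := by
    have := ENNReal.ofReal_eq_one.1 h1.symm
    exact this
  have h3 : ∫ t, ‖f t‖ ^ (2 : ENNReal).toReal = 1 := by
    rw [Real.rpow_inv_eq h0 zero_le_one (by simp)] at h2
    rw [h2, Real.one_rpow]
  simpa using h3

/-- For `K = w ⊗ u(λ)` with `u(λ)` of norm one, both the coefficient and the norm of the slice in
`t` recover `w(s)`. The indicator is needed because nothing is assumed about `u` off `S`. -/
theorem ae_fiberCoeff {S : Set (Fin k → ℝ)} {u : (Fin k → ℝ) → (Fin d → ℝ) → ℂ}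
    (hS : MeasurableSet S) (hu : Measurable (Function.uncurry u))
    (hu1 : ∀ lam ∈ S, eLpNorm (u lam) 2 volume = 1) {K : DirectInt v} (hK : MemFibered v S u K) :
    ∀ᵐ p ∂((plancherelMeasure v).prod volume),
      S.indicator 1 p.1 * ‖fiberCoeff u K p‖ ^ 2 = ∫ t, ‖K (p.1, p.2, t)‖ ^ 2 := by
  have hm : Measurable fun p : (Fin k → ℝ) × (Fin d → ℝ) => ∫ t, ‖K (p.1, p.2, t)‖ ^ 2 := by
    have h : Measurable fun r : ((Fin k → ℝ) × (Fin d → ℝ)) × (Fin d → ℝ) =>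
        ‖K (r.1.1, r.1.2, r.2)‖ ^ 2 :=
      ((measurable_direct K).comp MeasurableEquiv.prodAssoc.measurable).norm.pow_const 2
    exact h.stronglyMeasurable.integral_prod_right'.measurable
  have hm' : Measurable fun p : (Fin k → ℝ) × (Fin d → ℝ) =>
      (S.indicator 1 p.1 : ℝ) * ‖fiberCoeff u K p‖ ^ 2 :=
    ((measurable_one.indicator hS).comp measurable_fst).mul
      ((measurable_fiberCoeff hu K).norm.pow_const 2)
  refine (Measure.ae_prod_iff_ae_ae (p := fun p : (Fin k → ℝ) × (Fin d → ℝ) =>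
    (S.indicator 1 p.1 : ℝ) * ‖fiberCoeff u K p‖ ^ 2 = ∫ t, ‖K (p.1, p.2, t)‖ ^ 2)
    (measurableSet_eq_fun hm' hm)).2 ?_
  filter_upwards [hK] with lam hlam
  by_cases hl : lam ∈ S
  · obtain ⟨w, hw⟩ := hlam.1 hl
    filter_upwards [Measure.ae_ae_of_ae_prod hw] with s hs
    have hul : Measurable (u lam) := hu.comp measurable_prodMk_left
    have h1 := integral_norm_sq_eq_one hul (hu1 lam hl)
    have h2 : fiberCoeff u K (lam, s) = w s := by
      have h3 : fiberCoeff u K (lam, s) = ∫ t, w s * ((‖u lam t‖ ^ 2 : ℝ) : ℂ) := by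
        refine integral_congr_ae ?_
        filter_upwards [hs] with t ht
        rw [ht, mul_assoc, ← Complex.normSq_eq_conj_mul_self, Complex.normSq_eq_norm_sq]
      rw [h3, integral_const_mul, integral_complex_ofReal, h1]
      simp
    have h4 : ∫ t, ‖K (lam, s, t)‖ ^ 2 = ∫ t, ‖w s‖ ^ 2 * ‖u lam t‖ ^ 2 := by
      refine integral_congr_ae ?_
      filter_upwards [hs] with t ht
      rw [ht, norm_mul, RCLike.norm_conj, mul_pow]
    rw [h2, h4, integral_const_mul, h1]
    simp [hl]
  · filter_upwards [Measure.ae_ae_of_ae_prod (hlam.2 hl)] with s hs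
    have h4 : ∫ t, ‖K (lam, s, t)‖ ^ 2 = ∫ t : Fin d → ℝ, (0 : ℝ) := by
      refine integral_congr_ae ?_
      filter_upwards [hs] with t ht
      rw [ht]
      simp
    rw [h4]
    simp [hl]

theorem measurePreserving_assoc : MeasurePreserving
    (MeasurableEquiv.prodAssoc : ((Fin k → ℝ) × (Fin d → ℝ)) × (Fin d → ℝ) ≃ᵐ _)
    (((plancherelMeasure v).prod volume).prod volume) ((plancherelMeasure v).prod volume) :=
  measurePreserving_prodAssoc _ _ _

/-- Integrating the fibrewise identity over `(λ, s)` shows that passing to the coefficient is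
isometric, so only scalar functions of `(λ, s)` remain to be treated. -/
theorem integrable_fiberCoeff {S : Set (Fin k → ℝ)} {u : (Fin k → ℝ) → (Fin d → ℝ) → ℂ}
    (hS : MeasurableSet S) (hu : Measurable (Function.uncurry u))
    (hu1 : ∀ lam ∈ S, eLpNorm (u lam) 2 volume = 1) {K : DirectInt v} (hK : MemFibered v S u K) :
    Integrable (fun p => S.indicator 1 p.1 * ‖fiberCoeff u K p‖ ^ 2)
      ((plancherelMeasure v).prod volume) ∧
    ∫ p, S.indicator 1 p.1 * ‖fiberCoeff u K p‖ ^ 2 ∂((plancherelMeasure v).prod volume)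
      = ‖K‖ ^ 2 := by
  have h1 : Integrable (fun p => ‖K p‖ ^ 2) ((plancherelMeasure v).prod volume) :=
    (memLp_two_iff_integrable_sq_norm (Lp.memLp K).1).1 (Lp.memLp K)
  have h2 := (measurePreserving_assoc (v := v)).integrable_comp_of_integrable h1
  have h3 := ae_fiberCoeff hS hu hu1 hK
  refine ⟨h2.integral_prod_left.congr (h3.mono fun p hp => hp.symm), ?_⟩
  rw [integral_congr_ae h3]
  have h4 : ‖K‖ ^ 2 = ∫ p, ‖K p‖ ^ 2 ∂((plancherelMeasure v).prod volume) := by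
    have h5 : (‖K‖ ^ 2 : ℝ) = RCLike.re (inner ℂ K K) := norm_sq_eq_re_inner (𝕜 := ℂ) K
    rw [h5, L2.inner_def, ← integral_re (L2.integrable_inner K K)]
    refine integral_congr_ae (Eventually.of_forall fun p => ?_)
    exact (norm_sq_eq_re_inner (𝕜 := ℂ) (K p)).symm
  rw [h4, ← integral_comp_of_measurePreserving measurePreserving_assoc h1.1]
  exact (integral_prod _ h2).symm

end TwoStep

namespace TwoStep

open scoped Matrix

variable {𝔫 : Type*} [LieRing 𝔫] [LieAlgebra ℝ 𝔫] {k d : ℕ} {v : Basis (Idx k d) ℝ 𝔫}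

/-! ### The window and its coefficients -/

/-- The cube `[0, 1)ᵈ`. -/
def unitBox (d : ℕ) : Set (Fin d → ℝ) := Set.pi Set.univ fun _ => Set.Ico 0 1

theorem measurableSet_unitBox (d : ℕ) : MeasurableSet (unitBox d) :=
  MeasurableSet.univ_pi fun _ => measurableSet_Ico

theorem volume_unitBox (d : ℕ) : volume (unitBox d) = 1 := by
  simp [unitBox, Real.volume_pi_Ico]

/-- The kernel `c 1_S(λ) 1_{[0,1)ᵈ}(s) conj u(λ, t)`. -/
def windowKernel (c : ℝ) (S : Set (Fin k → ℝ)) (u : (Fin k → ℝ) → (Fin d → ℝ) → ℂ)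
    (p : (Fin k → ℝ) × (Fin d → ℝ) × (Fin d → ℝ)) : ℂ :=
  (c * S.indicator 1 p.1 * (unitBox d).indicator 1 p.2.1 : ℝ) * conj (u p.1 p.2.2)

theorem measurable_windowKernel (c : ℝ) {S : Set (Fin k → ℝ)}
    {u : (Fin k → ℝ) → (Fin d → ℝ) → ℂ} (hS : MeasurableSet S)
    (hu : Measurable (Function.uncurry u)) : Measurable (windowKernel c S u) := by
  refine Measurable.mul (Complex.measurable_ofReal.comp ((measurable_const.mul ?_).mul ?_)) ?_
  · exact (measurable_one.indicator hS).comp measurable_fst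
  · exact (measurable_one.indicator (measurableSet_unitBox d)).comp
      (measurable_fst.comp measurable_snd)
  · exact Complex.continuous_conj.measurable.comp
      (hu.comp (measurable_fst.prodMk (measurable_snd.comp measurable_snd)))

/-- The squared modulus integrates to `c² μ(S)`, since the box has volume one and `u(λ)` has norm
one for `λ ∈ S`. -/
theorem memLp_windowKernel (c : ℝ) {S : Set (Fin k → ℝ)}
    {u : (Fin k → ℝ) → (Fin d → ℝ) → ℂ} (hS : MeasurableSet S)
    (hSf : plancherelMeasure v S ≠ ⊤)
    (hu : Measurable (Function.uncurry u)) (hu1 : ∀ lam ∈ S, eLpNorm (u lam) 2 volume = 1) :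
    MemLp (windowKernel c S u) 2 ((plancherelMeasure v).prod volume) := by
  have hm := measurable_windowKernel c hS hu
  have hn : ∀ lam (q : (Fin d → ℝ) × (Fin d → ℝ)), ‖windowKernel c S u (lam, q)‖ ^ 2
      = (c ^ 2 * S.indicator 1 lam) * ((unitBox d).indicator 1 q.1 * ‖u lam q.2‖ ^ 2) := by
    intro lam q
    simp only [windowKernel, norm_mul, RCLike.norm_conj, Complex.norm_real]
    by_cases h1 : lam ∈ S <;> by_cases h2 : q.1 ∈ unitBox d <;> simp [h1, h2, mul_pow]
  have hbox : Integrable ((unitBox d).indicator (1 : (Fin d → ℝ) → ℝ)) :=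
    (integrable_indicator_iff (measurableSet_unitBox d)).2
      (integrableOn_const (by simp [volume_unitBox]))
  have hs : ∀ lam ∈ S, Integrable (fun q : (Fin d → ℝ) × (Fin d → ℝ) =>
      (unitBox d).indicator 1 q.1 * ‖u lam q.2‖ ^ 2) := by
    intro lam hl
    have hul : Measurable (u lam) := hu.comp measurable_prodMk_left
    have h2 : MemLp (u lam) 2 := ⟨hul.aestronglyMeasurable, by simp [hu1 lam hl]⟩
    exact hbox.mul_prod ((memLp_two_iff_integrable_sq_norm h2.1).1 h2)
  rw [memLp_two_iff_integrable_sq_norm hm.aestronglyMeasurable,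
    integrable_prod_iff (hm.norm.pow_const 2).aestronglyMeasurable]
  constructor
  · refine Eventually.of_forall fun lam => ?_
    simp only [hn]
    by_cases hl : lam ∈ S
    · exact (hs lam hl).const_mul _
    · simp [hl]
  · have h1 : Integrable (fun lam => c ^ 2 * S.indicator (1 : (Fin k → ℝ) → ℝ) lam)
        (plancherelMeasure v) :=
      ((integrable_indicator_iff hS).2 (integrableOn_const hSf)).const_mul _
    refine h1.congr (Eventually.of_forall fun lam => ?_)
    have hn' : ∀ q : (Fin d → ℝ) × (Fin d → ℝ), ‖‖windowKernel c S u (lam, q)‖ ^ 2‖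
        = (c ^ 2 * S.indicator 1 lam) * ((unitBox d).indicator 1 q.1 * ‖u lam q.2‖ ^ 2) := fun q => by
      rw [Real.norm_of_nonneg (sq_nonneg _), hn]
    simp only [hn']
    by_cases hl : lam ∈ S
    · have hul : Measurable (u lam) := hu.comp measurable_prodMk_left
      rw [integral_const_mul, Measure.volume_eq_prod,
        integral_prod_mul (f := (unitBox d).indicator (1 : (Fin d → ℝ) → ℝ))
        (g := fun t => ‖u lam t‖ ^ 2), integral_norm_sq_eq_one hul (hu1 lam hl),
        integral_indicator_one (measurableSet_unitBox d)]
      simp [measureReal_def, volume_unitBox]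
    · simp [hl]

/-- The window contains `conj u`, so integrating out `t` first produces `fiberCoeff u K`. -/
theorem inner_actDirect_window (c : ℝ) {S : Set (Fin k → ℝ)}
    {u : (Fin k → ℝ) → (Fin d → ℝ) → ℂ}
    (hL : MemLp (windowKernel c S u) 2 ((plancherelMeasure v).prod volume))
    (γ : Grp v) (K : DirectInt v) :
    inner ℂ (actDirect v γ (hL.toLp _)) K = ∫ p, conj (phase v γ p.1 p.2) *
      (c * S.indicator 1 p.1 * (unitBox d).indicator 1 (p.2 - γ.2.2) : ℝ) * fiberCoeff u K p
        ∂((plancherelMeasure v).prod volume) := by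
  have hae : (fun p => inner ℂ (actDirect v γ (hL.toLp _) p) (K p))
      =ᵐ[(plancherelMeasure v).prod volume] fun p => conj (phase v γ p.1 p.2.1) *
      (c * S.indicator 1 p.1 * (unitBox d).indicator 1 (p.2.1 - γ.2.2) : ℝ) *
        (K p * u p.1 p.2.2) := by
    filter_upwards [coeFn_actDirect v γ (hL.toLp _),
      (measurePreserving_shift v γ.2.2).quasiMeasurePreserving.ae hL.coeFn_toLp] with p h1 h2
    rw [RCLike.inner_apply, h1, h2, windowKernel, map_mul, map_mul, Complex.conj_conj,
      Complex.conj_ofReal]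
    simp only [shift]
    ring
  have hint := (L2.integrable_inner (𝕜 := ℂ) (actDirect v γ (hL.toLp _)) K).congr hae
  have hint' := (measurePreserving_assoc (v := v)).integrable_comp_of_integrable hint
  rw [L2.inner_def, integral_congr_ae hae,
    ← integral_comp_of_measurePreserving measurePreserving_assoc hint.1]
  refine (integral_prod _ hint').trans (integral_congr_ae (Eventually.of_forall fun p => ?_))
  simp only
  rw [fiberCoeff, ← integral_const_mul]
  rfl

/-! ### The quasi-lattice -/

/-- The elements `exp(∑ xᵢ Xᵢ) exp(a ∑ mₗ Zₗ) exp(a ∑ nⱼ Yⱼ)` of `N`. -/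
def latticePoint (v : Basis (Idx k d) ℝ 𝔫) (a : ℝ)
    (j : (Fin d → ℤ) × ((Fin k → ℤ) × (Fin d → ℤ))) : Grp v :=
  ((fun l => a * j.2.1 l) + lieXY v (fun i => (j.1 i : ℝ)) (fun i => a * j.2.2 i),
    (fun i => a * j.2.2 i), fun i => (j.1 i : ℝ))

/-- With the `X`-factor first, the `lieXY` term in the `Z`-coordinate cancels the contribution of `x
B(λ)` from the shifted `s`. The exponentials are therefore the same for every box. -/
theorem phase_latticePoint (a : ℝ) (j : (Fin d → ℤ) × ((Fin k → ℤ) × (Fin d → ℤ)))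
    (lam : Fin k → ℝ) (s : Fin d → ℝ) :
    phase v (latticePoint v a j) lam (s + fun i => (j.1 i : ℝ))
      = ech (pairing (phiB v (lam, s)) (fun l => a * j.2.1 l, fun i => a * j.2.2 i)) := by
  rw [phase]
  congr 1
  simp only [latticePoint, phiB, pairing, dotProduct_add, Matrix.add_vecMul, add_dotProduct,
    dotProduct_lieXY]
  ring

/-- The function on `ℝᵏ × ℝᵈ` whose Fourier coefficients are the frame coefficients. -/
def coeffFun (v : Basis (Idx k d) ℝ 𝔫) (c : ℝ) (S : Set (Fin k → ℝ))
    (W : (Fin k → ℝ) × (Fin d → ℝ) → ℂ) (x : Fin d → ℝ) (ζ : (Fin k → ℝ) × (Fin d → ℝ)) : ℂ :=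
  (c * S.indicator 1 ζ.1 * (unitBox d).indicator 1 (ζ.2 ᵥ* (matB v ζ.1)⁻¹) : ℝ) *
    W (ζ.1, ζ.2 ᵥ* (matB v ζ.1)⁻¹ + x)

theorem measurable_coeffFun (c : ℝ) {S : Set (Fin k → ℝ)} (hS : MeasurableSet S)
    {W : (Fin k → ℝ) × (Fin d → ℝ) → ℂ} (hW : Measurable W) (x : Fin d → ℝ) :
    Measurable (coeffFun v c S W x) := by
  have h := measurable_vecMul_matB_inv v
  refine Measurable.mul (Complex.measurable_ofReal.comp ((measurable_const.mul ?_).mul ?_)) ?_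
  · exact (measurable_one.indicator hS).comp measurable_fst
  · exact (measurable_one.indicator (measurableSet_unitBox d)).comp h
  · exact hW.comp (measurable_fst.prodMk (h.add measurable_const))

theorem coeffFun_phiB (c : ℝ) (S : Set (Fin k → ℝ)) (W : (Fin k → ℝ) × (Fin d → ℝ) → ℂ)
    (x : Fin d → ℝ) {p : (Fin k → ℝ) × (Fin d → ℝ)} (hp : (matB v p.1).det ≠ 0) :
    coeffFun v c S W x (phiB v p) =
      (c * S.indicator 1 p.1 * (unitBox d).indicator 1 p.2 : ℝ) * W (p.1, p.2 + x) := by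
  simp only [coeffFun, phiB, Matrix.vecMul_vecMul, Matrix.mul_nonsing_inv _ (Ne.isUnit hp),
    Matrix.vecMul_one]

theorem measurePreserving_translate (x : Fin d → ℝ) :
    MeasurePreserving (fun p : (Fin k → ℝ) × (Fin d → ℝ) => (p.1, p.2 + x))
      ((plancherelMeasure v).prod volume) ((plancherelMeasure v).prod volume) :=
  (MeasurePreserving.id _).prod (measurePreserving_add_right volume x)

theorem ae_prod_det_ne_zero :
    ∀ᵐ p ∂((plancherelMeasure v).prod (volume : Measure (Fin d → ℝ))), (matB v p.1).det ≠ 0 :=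
  Measure.quasiMeasurePreserving_fst.ae ae_plancherel_det_ne_zero

/-- Translate `s` by `x` to return to the box `[0,1)ᵈ`, then substitute `ζ = (λ, s B(λ))`, which
absorbs the Plancherel density: the frame coefficient becomes a Euclidean Fourier coefficient. -/
theorem inner_actDirect_latticePoint (hv : IsAdapted v) (c : ℝ) {S : Set (Fin k → ℝ)}
    (hS : MeasurableSet S) {u : (Fin k → ℝ) → (Fin d → ℝ) → ℂ}
    (hu : Measurable (Function.uncurry u))
    (hL : MemLp (windowKernel c S u) 2 ((plancherelMeasure v).prod volume))
    (K : DirectInt v) (a : ℝ) (j : (Fin d → ℤ) × ((Fin k → ℤ) × (Fin d → ℤ))) :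
    inner ℂ (actDirect v (latticePoint v a j) (hL.toLp _)) K =
      ∫ ζ, ech (-pairing ζ (fun l => a * j.2.1 l, fun i => a * j.2.2 i)) *
        coeffFun v c S (fiberCoeff u K) (fun i => (j.1 i : ℝ)) ζ := by
  have hW := measurable_fiberCoeff hu K
  set γ := latticePoint v a j with hγ
  have hFm : Measurable fun p : (Fin k → ℝ) × (Fin d → ℝ) => conj (phase v γ p.1 p.2) *
      (c * S.indicator 1 p.1 * (unitBox d).indicator 1 (p.2 - γ.2.2) : ℝ) * fiberCoeff u K p := by
    refine (Measurable.mul ?_ (Complex.measurable_ofReal.comp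
      ((measurable_const.mul ?_).mul ?_))).mul hW
    · have h1 : Measurable fun p : (Fin k → ℝ) × (Fin d → ℝ) => phase v γ p.1 p.2 :=
        measurable_ech.comp (continuous_pairing.measurable.comp
          (measurable_phiB.prodMk measurable_const))
      exact Complex.continuous_conj.measurable.comp h1
    · exact (measurable_one.indicator hS).comp measurable_fst
    · exact (measurable_one.indicator (measurableSet_unitBox d)).comp
        (measurable_snd.sub measurable_const)
  have hGm : Measurable fun ζ : (Fin k → ℝ) × (Fin d → ℝ) =>
      ech (-pairing ζ (fun l => a * j.2.1 l, fun i => a * j.2.2 i)) *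
        coeffFun v c S (fiberCoeff u K) (fun i => (j.1 i : ℝ)) ζ :=
    (measurable_ech.comp (continuous_pairing.measurable.comp
      (measurable_id.prodMk measurable_const)).neg).mul (measurable_coeffFun c hS hW _)
  rw [inner_actDirect_window, ← integral_comp_of_measurePreserving
    (measurePreserving_translate fun i => (j.1 i : ℝ)) hFm.aestronglyMeasurable,
    ← integral_comp_of_measurePreserving hv.measurePreserving_phiB hGm.aestronglyMeasurable]
  refine integral_congr_ae ?_
  filter_upwards [ae_prod_det_ne_zero (v := v)] with p hp
  rw [coeffFun_phiB _ _ _ _ hp, phase_latticePoint, conj_ech]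
  simp only [hγ, latticePoint, add_sub_cancel_right, mul_assoc]

/-- The frame coefficients with a fixed `X`-coordinate. -/
theorem hasSum_latticePoint (hv : IsAdapted v) {c R : ℝ} (hR : 0 < R)
    (hc : (2 * R) ^ (k + d) * c ^ 2 = 1) {S : Set (Fin k → ℝ)}
    (hS : MeasurableSet S) (hSc : S ⊆ crossSection v)
    (hSR : ∀ lam ∈ S, ∀ s ∈ unitBox d, (∀ i, |lam i| < R) ∧ ∀ j, |(s ᵥ* matB v lam) j| < R)
    {u : (Fin k → ℝ) → (Fin d → ℝ) → ℂ} (hu : Measurable (Function.uncurry u))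
    (hu1 : ∀ lam ∈ S, eLpNorm (u lam) 2 volume = 1)
    (hL : MemLp (windowKernel c S u) 2 ((plancherelMeasure v).prod volume))
    {K : DirectInt v} (hK : MemFibered v S u K) (x : Fin d → ℤ) :
    HasSum (fun n : (Fin k → ℤ) × (Fin d → ℤ) =>
        ‖inner ℂ (actDirect v (latticePoint v (2 * R)⁻¹ (x, n)) (hL.toLp _)) K‖ ^ 2)
      (∫ p in {p : (Fin k → ℝ) × (Fin d → ℝ) | (p.2 - fun i => (x i : ℝ)) ∈ unitBox d},
        S.indicator 1 p.1 * ‖fiberCoeff u K p‖ ^ 2 ∂((plancherelMeasure v).prod volume)) := by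
  have hW := measurable_fiberCoeff hu K
  have hm := measurable_coeffFun (v := v) c hS hW (fun i => (x i : ℝ))
  have hint := (integrable_fiberCoeff hS hu hu1 hK).1
  set xr : Fin d → ℝ := fun i => (x i : ℝ)
  have hT : MeasurableSet {p : (Fin k → ℝ) × (Fin d → ℝ) | p.2 - xr ∈ unitBox d} :=
    (measurable_snd.sub measurable_const) (measurableSet_unitBox d)
  have hsq : ∀ᵐ p ∂((plancherelMeasure v).prod volume),
      ‖coeffFun v c S (fiberCoeff u K) xr (phiB v p)‖ ^ 2
        = c ^ 2 * {p : (Fin k → ℝ) × (Fin d → ℝ) | p.2 - xr ∈ unitBox d}.indicator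
          (fun p => S.indicator 1 p.1 * ‖fiberCoeff u K p‖ ^ 2) (p.1, p.2 + xr) := by
    filter_upwards [ae_prod_det_ne_zero (v := v)] with p hp
    rw [coeffFun_phiB _ _ _ _ hp, norm_mul, Complex.norm_real, mul_pow]
    by_cases h1 : p.1 ∈ S <;> by_cases h2 : p.2 ∈ unitBox d <;> simp [h1, h2, Set.indicator]
  have hi1 : Integrable (fun p => c ^ 2 *
      {p : (Fin k → ℝ) × (Fin d → ℝ) | p.2 - xr ∈ unitBox d}.indicator
          (fun p => S.indicator 1 p.1 * ‖fiberCoeff u K p‖ ^ 2) (p.1, p.2 + xr))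
      ((plancherelMeasure v).prod volume) :=
    ((measurePreserving_translate xr).integrable_comp_of_integrable
      (hint.indicator hT)).const_mul _
  have hmem : MemLp (coeffFun v c S (fiberCoeff u K) xr) 2 := by
    rw [memLp_two_iff_integrable_sq_norm hm.aestronglyMeasurable,
      ← hv.measurePreserving_phiB.integrable_comp (hm.norm.pow_const 2).aestronglyMeasurable]
    exact hi1.congr (hsq.mono fun p hp => hp.symm)
  -- The normalisation `hc` cancels the volume factor of the cube against the `c²` of the window.
  have hnorm : (2 * R) ^ (k + d) * ∫ ζ, ‖coeffFun v c S (fiberCoeff u K) xr ζ‖ ^ 2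
      = ∫ p in {p : (Fin k → ℝ) × (Fin d → ℝ) | p.2 - xr ∈ unitBox d},
        S.indicator 1 p.1 * ‖fiberCoeff u K p‖ ^ 2 ∂((plancherelMeasure v).prod volume) := by
    rw [← integral_comp_of_measurePreserving hv.measurePreserving_phiB
      (hm.norm.pow_const 2).aestronglyMeasurable, integral_congr_ae hsq, integral_const_mul,
      ← mul_assoc, hc, one_mul, integral_comp_of_measurePreserving
      (measurePreserving_translate xr) (hint.indicator hT).1, integral_indicator hT]
  -- Off the zeros of `coeffFun`, `ζ` is the image under `phiB` of a point of `S × [0,1)ᵈ`, so `hSR`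
  -- applies.
  have hsupp : ∀ p, coeffFun v c S (fiberCoeff u K) xr p ≠ 0 →
      (∀ i, |p.1 i| < R) ∧ ∀ j, |p.2 j| < R := by
    intro p hp
    have h1 : p.1 ∈ S := by
      by_contra h
      exact hp (by simp [coeffFun, h])
    have h2 : p.2 ᵥ* (matB v p.1)⁻¹ ∈ unitBox d := by
      by_contra h
      exact hp (by simp [coeffFun, h])
    have h3 := hSR p.1 h1 _ h2
    have h4 := phiB_eq (v := v) p.1 p.2 (hSc h1)
    rw [phiB, Prod.mk.injEq] at h4
    rwa [h4.2] at h3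
  have h := hasSum_scaledCube hR hm hmem hsupp
  rw [hnorm] at h
  refine hasSum_of_eq h fun n => ?_
  rw [inner_actDirect_latticePoint hv c hS hu hL]

end TwoStep

namespace TwoStep

open scoped Matrix

variable {𝔫 : Type*} [LieRing 𝔫] [LieAlgebra ℝ 𝔫] {k d : ℕ} {v : Basis (Idx k d) ℝ 𝔫}

/-! ### Summation over the quasi-lattice -/

theorem hasSum_prod_of_nonneg {α β : Type*} {f : α × β → ℝ} (hf : ∀ p, 0 ≤ f p) {g : α → ℝ} {s : ℝ}
    (h1 : ∀ x, HasSum (fun y => f (x, y)) (g x)) (h2 : HasSum g s) : HasSum f s := by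
  have hs : Summable f := by
    rw [summable_prod_of_nonneg hf]
    exact ⟨fun x => (h1 x).summable, by simpa only [(h1 _).tsum_eq] using h2.summable⟩
  have h3 := hs.hasSum.prod_fiberwise h1
  rw [h2.unique h3]
  exact hs.hasSum

theorem int_add_unique {m m' : ℤ} {c c' : ℝ} (hc : c ∈ Set.Ico (0 : ℝ) 1)
    (hc' : c' ∈ Set.Ico (0 : ℝ) 1) (h : m + c = m' + c') : m = m' := by
  have h1 : ⌊(m : ℝ) + c⌋ = m := by
    rw [Int.floor_intCast_add, Int.floor_eq_zero_iff.2 hc, add_zero]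
  have h2 : ⌊(m' : ℝ) + c'⌋ = m' := by
    rw [Int.floor_intCast_add, Int.floor_eq_zero_iff.2 hc', add_zero]
  rw [← h1, ← h2, h]

theorem hasSum_boxes {μ : Measure ((Fin k → ℝ) × (Fin d → ℝ))}
    {D : (Fin k → ℝ) × (Fin d → ℝ) → ℝ} (hD : Integrable D μ) :
    HasSum (fun x : Fin d → ℤ => ∫ p in {p : (Fin k → ℝ) × (Fin d → ℝ) |
      (p.2 - fun i => (x i : ℝ)) ∈ unitBox d}, D p ∂μ) (∫ p, D p ∂μ) := by
  have hm : ∀ x : Fin d → ℤ, MeasurableSet {p : (Fin k → ℝ) × (Fin d → ℝ) |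
      (p.2 - fun i => (x i : ℝ)) ∈ unitBox d} := fun x =>
    (measurable_snd.sub measurable_const) (measurableSet_unitBox d)
  have hdis : Pairwise (Function.onFun Disjoint fun x : Fin d → ℤ =>
      {p : (Fin k → ℝ) × (Fin d → ℝ) | (p.2 - fun i => (x i : ℝ)) ∈ unitBox d}) := by
    intro x y hxy
    refine Set.disjoint_left.2 fun p hp hp' => hxy (funext fun i => ?_)
    exact int_add_unique (hp i trivial) (hp' i trivial) (by simp)
  have hun : (⋃ x : Fin d → ℤ, {p : (Fin k → ℝ) × (Fin d → ℝ) |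
      (p.2 - fun i => (x i : ℝ)) ∈ unitBox d}) = Set.univ := by
    refine Set.eq_univ_of_forall fun p => Set.mem_iUnion.2 ⟨fun i => ⌊p.2 i⌋, fun i _ => ?_⟩
    exact ⟨Int.fract_nonneg (p.2 i), Int.fract_lt_one (p.2 i)⟩
  have h := hasSum_integral_iUnion hm hdis hD.integrableOn
  rwa [hun, Measure.restrict_univ] at h

/-- In this form the commutator involves only the `Y`-coordinate of the whole product, so a
factorisation can be solved triangularly: first `x`, then `y`, then `z`. -/
theorem latticePoint_mul (a : ℝ) (j : (Fin d → ℤ) × ((Fin k → ℤ) × (Fin d → ℤ))) (c : Grp v) :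
    latticePoint v a j * c = ((fun l => a * j.2.1 l) +
      lieXY v (fun i => (j.1 i : ℝ)) ((fun i => a * j.2.2 i) + c.2.1) + c.1,
      (fun i => a * j.2.2 i) + c.2.1, (fun i => (j.1 i : ℝ)) + c.2.2) := by
  refine Prod.ext ?_ rfl
  change (fun l => a * (j.2.1 l : ℝ)) + lieXY v (fun i => (j.1 i : ℝ)) (fun i => a * j.2.2 i)
    + c.1 + lieXY v (fun i => (j.1 i : ℝ)) c.2.1 = _
  rw [lieXY_add_right]
  abel_nf

/-- The fundamental domain `[0, a)ᵏ × [0, a)ᵈ × [0, 1)ᵈ`. -/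
def tile (v : Basis (Idx k d) ℝ 𝔫) (a : ℝ) : Set (Grp v) :=
  (Set.pi Set.univ fun _ => Set.Ico 0 a) ×ˢ (Set.pi Set.univ fun _ => Set.Ico 0 a) ×ˢ unitBox d

theorem scaled_add_unique {a : ℝ} (ha : 0 < a) {m m' : ℤ} {c c' : ℝ} (hc : c ∈ Set.Ico 0 a)
    (hc' : c' ∈ Set.Ico 0 a) (h : a * m + c = a * m' + c') : m = m' := by
  refine int_add_unique (c := c / a) (c' := c' / a) ?_ ?_ ?_
  · exact ⟨div_nonneg hc.1 ha.le, (div_lt_one ha).2 hc.2⟩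
  · exact ⟨div_nonneg hc'.1 ha.le, (div_lt_one ha).2 hc'.2⟩
  · field_simp
    linarith

theorem eq_of_latticePoint_mul {a : ℝ} (ha : 0 < a)
    {j j' : (Fin d → ℤ) × ((Fin k → ℤ) × (Fin d → ℤ))} {c c' : Grp v} (hc : c ∈ tile v a)
    (hc' : c' ∈ tile v a) (h : latticePoint v a j * c = latticePoint v a j' * c') : j = j' := by
  rw [latticePoint_mul, latticePoint_mul] at h
  have h1 := congrArg Prod.fst h
  have h2 := congrArg (fun n : Grp v => n.2.1) h
  have h3 := congrArg (fun n : Grp v => n.2.2) h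
  simp only at h1 h2 h3
  have hx : j.1 = j'.1 := funext fun i =>
    int_add_unique (hc.2.2 i trivial) (hc'.2.2 i trivial) (congrFun h3 i)
  have hy : j.2.2 = j'.2.2 := funext fun i =>
    scaled_add_unique ha (hc.2.1 i trivial) (hc'.2.1 i trivial) (congrFun h2 i)
  rw [h2, hx, add_right_comm, add_right_comm _ _ c'.1, add_left_inj] at h1
  have hz : j.2.1 = j'.2.1 := funext fun i =>
    scaled_add_unique ha (hc.1 i trivial) (hc'.1 i trivial) (congrFun h1 i)
  exact Prod.ext hx (Prod.ext hz hy)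

theorem exists_scaled_add {a : ℝ} (ha : 0 < a) (r : ℝ) :
    r - a * ⌊r / a⌋ ∈ Set.Ico 0 a := by
  have h1 := Int.fract_nonneg (r / a)
  have h2 := Int.fract_lt_one (r / a)
  have h3 : r - a * ⌊r / a⌋ = a * Int.fract (r / a) := by
    rw [Int.fract]
    field_simp
  rw [h3]
  exact ⟨by positivity, by nlinarith⟩

theorem exists_latticePoint_mul {a : ℝ} (ha : 0 < a) (n : Grp v) :
    ∃ j, ∃ c ∈ tile v a, latticePoint v a j * c = n := by
  let x : Fin d → ℤ := fun i => ⌊n.2.2 i⌋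
  let y : Fin d → ℤ := fun i => ⌊n.2.1 i / a⌋
  let r : Fin k → ℝ := n.1 - lieXY v (fun i => (x i : ℝ)) n.2.1
  let z : Fin k → ℤ := fun i => ⌊r i / a⌋
  let c : Grp v := (r - fun i => a * (z i : ℝ), n.2.1 - fun i => a * (y i : ℝ),
    n.2.2 - fun i => (x i : ℝ))
  refine ⟨(x, z, y), c, ⟨fun i _ => exists_scaled_add ha _, fun i _ => exists_scaled_add ha _,
    fun i _ => ⟨Int.fract_nonneg _, Int.fract_lt_one _⟩⟩, ?_⟩
  rw [latticePoint_mul]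
  refine Prod.ext ?_ (Prod.ext ?_ ?_)
  · simp only [c, r, add_sub_cancel]
    abel
  · simp only [c, add_sub_cancel]
  · simp only [c, add_sub_cancel]

theorem latticePoint_injective {a : ℝ} (ha : 0 < a) : Function.Injective (latticePoint v a) := by
  intro j j' h
  have h0 : (1 : Grp v) ∈ tile v a :=
    ⟨fun _ _ => ⟨le_rfl, ha⟩, fun _ _ => ⟨le_rfl, ha⟩, fun _ _ => ⟨le_rfl, one_pos⟩⟩
  exact eq_of_latticePoint_mul ha h0 h0 (by rw [h])

/-- The set need not be closed under multiplication; only the tiling matters. The translates of the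
half-open tile are in fact disjoint. -/
theorem isQuasiLattice_latticePoint {a : ℝ} (ha : 0 < a) :
    IsQuasiLattice (Set.range (latticePoint v a)) := by
  refine ⟨Set.countable_range _, tile v a, ?_, ?_, ?_, ?_⟩
  · exact (MeasurableSet.univ_pi fun _ => measurableSet_Ico).prod
      ((MeasurableSet.univ_pi fun _ => measurableSet_Ico).prod (measurableSet_unitBox d))
  · have hK : IsCompact ((Set.Icc (0 : Fin k → ℝ) fun _ => a) ×ˢ (Set.Icc (0 : Fin d → ℝ) fun _ => a)
        ×ˢ (Set.Icc (0 : Fin d → ℝ) 1)) :=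
      isCompact_Icc.prod (isCompact_Icc.prod isCompact_Icc)
    have hsub : (tile v a : Set ((Fin k → ℝ) × (Fin d → ℝ) × (Fin d → ℝ))) ⊆
        (Set.Icc (0 : Fin k → ℝ) fun _ => a) ×ˢ (Set.Icc (0 : Fin d → ℝ) fun _ => a)
        ×ˢ (Set.Icc (0 : Fin d → ℝ) 1) := fun p hp =>
      ⟨⟨fun i => (hp.1 i trivial).1, fun i => (hp.1 i trivial).2.le⟩,
        ⟨fun i => (hp.2.1 i trivial).1, fun i => (hp.2.1 i trivial).2.le⟩,
        ⟨fun i => (hp.2.2 i trivial).1, fun i => (hp.2.2 i trivial).2.le⟩⟩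
    exact hK.closure_of_subset hsub
  · refine Set.eq_univ_of_forall fun n => ?_
    obtain ⟨j, c, hc, rfl⟩ := exists_latticePoint_mul ha n
    exact Set.mem_biUnion ⟨j, rfl⟩ ⟨c, hc, rfl⟩
  · rintro _ ⟨j, rfl⟩ _ ⟨j', rfl⟩ hne
    have hempty : ((fun n => latticePoint v a j * n) '' tile v a) ∩
        ((fun n => latticePoint v a j' * n) '' tile v a) = ∅ := by
      refine Set.eq_empty_of_forall_notMem ?_
      rintro _ ⟨⟨c, hc, rfl⟩, c', hc', h⟩
      exact hne (by rw [eq_of_latticePoint_mul ha hc' hc h])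
    rw [hempty, measure_empty]

/-! ### Bounded sets of frequencies -/

/-- The pairs `(λ, s B(λ))` lie in the continuous image of a compact set. The resulting `R` is the
half-side of the cube for the Fourier series. -/
theorem exists_bound {I : Set (Fin k → ℝ)} (hI : Bornology.IsBounded I) :
    ∃ R : ℝ, 0 < R ∧ ∀ lam ∈ I, ∀ s ∈ unitBox d,
      (∀ i, |lam i| < R) ∧ ∀ j, |(s ᵥ* matB v lam) j| < R := by
  have hK : IsCompact (closure I ×ˢ Set.Icc (0 : Fin d → ℝ) 1) :=
    hI.isCompact_closure.prod isCompact_Icc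
  have hc : Continuous (phiB v) := continuous_fst.prodMk (continuous_vecMul_matB v)
  obtain ⟨R, hR⟩ := (hK.image hc).isBounded.exists_norm_le
  -- This makes the bound positive and the inequalities strict.
  refine ⟨max R 0 + 1, by positivity, fun lam hl s hs => ?_⟩
  have h1 : ‖phiB v (lam, s)‖ ≤ R := hR _ ⟨(lam, s), ⟨subset_closure hl,
    fun i => (hs i trivial).1, fun i => (hs i trivial).2.le⟩, rfl⟩
  have h2 : ‖phiB v (lam, s)‖ < max R 0 + 1 := by
    have := le_max_left R 0
    linarith
  rw [phiB, Prod.norm_mk, max_lt_iff] at h2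
  exact ⟨fun i => (norm_le_pi_norm lam i).trans_lt h2.1,
    fun j => (norm_le_pi_norm (s ᵥ* matB v lam) j).trans_lt h2.2⟩

theorem plancherelMeasure_ne_top {I : Set (Fin k → ℝ)} (hI : Bornology.IsBounded I) :
    plancherelMeasure v I ≠ ⊤ := by
  obtain ⟨M, hM⟩ := (hI.isCompact_closure.image (continuous_det_matB v)).isBounded.exists_norm_le
  refine ((measure_mono subset_closure).trans_lt ?_).ne
  rw [plancherelMeasure, withDensity_apply _ isClosed_closure.measurableSet]
  refine (setLIntegral_mono' (g := fun _ => ENNReal.ofReal M) isClosed_closure.measurableSet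
    fun lam hl => ?_).trans_lt ?_
  · exact ENNReal.ofReal_le_ofReal (hM _ ⟨lam, hl, rfl⟩)
  · rw [setLIntegral_const]
    exact ENNReal.mul_lt_top ENNReal.ofReal_lt_top hI.isCompact_closure.measure_lt_top

/-! ### Membership in the fibred space -/

/-- Band-limitedness lets the spectral set `S`, possibly unbounded, be replaced by the bounded set
`S ∩ I`. -/
theorem MemFibered.inter {S I : Set (Fin k → ℝ)} {u : (Fin k → ℝ) → (Fin d → ℝ) → ℂ}
    {K : DirectInt v} (hK : MemFibered v S u K)
    (hI : ∀ᵐ lam ∂(plancherelMeasure v), lam ∉ I →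
      (fun p : (Fin d → ℝ) × (Fin d → ℝ) => K (lam, p)) =ᵐ[volume] 0) :
    MemFibered v (S ∩ I) u K := by
  filter_upwards [hK, hI] with lam h1 h2
  refine ⟨fun h => h1.1 h.1, fun h => ?_⟩
  by_cases hS : lam ∈ S
  · exact h2 fun hi => h ⟨hS, hi⟩
  · exact h1.2 hS

theorem memFibered_windowKernel (c : ℝ) {S S' : Set (Fin k → ℝ)} (hSS : S' ⊆ S)
    {u : (Fin k → ℝ) → (Fin d → ℝ) → ℂ}
    (hL : MemLp (windowKernel c S' u) 2 ((plancherelMeasure v).prod volume)) :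
    MemFibered v S u (hL.toLp _) := by
  filter_upwards [Measure.ae_ae_of_ae_prod hL.coeFn_toLp] with lam hlam
  constructor
  · intro _
    have hw : MemLp ((unitBox d).indicator fun _ => ((c * S'.indicator 1 lam : ℝ) : ℂ)) 2 volume :=
      memLp_indicator_const 2 (measurableSet_unitBox d) _ (Or.inr (by simp [volume_unitBox]))
    -- The factor `w` is a multiple of the indicator of the box, and is zero for `λ` in `S` but not
    -- in `S'`.
    refine ⟨hw.toLp _, ?_⟩
    filter_upwards [hlam, Measure.quasiMeasurePreserving_fst.ae hw.coeFn_toLp] with p h1 h2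
    rw [h1, h2, windowKernel]
    by_cases hp : p.1 ∈ unitBox d <;> simp [hp]
  · intro hS
    filter_upwards [hlam] with p h1
    rw [h1, windowKernel]
    have hS' : lam ∉ S' := fun h => hS (hSS h)
    simp [hS']

end TwoStep

end

/-! ### The Parseval frame -/

theorem mainTheorem1 {𝔫 : Type*} [LieRing 𝔫] [LieAlgebra ℝ 𝔫] {k d : ℕ}
    (v : Module.Basis (TwoStep.Idx k d) ℝ 𝔫) (hv : TwoStep.IsAdapted v)
    (H : Submodule ℂ (TwoStep.L2N v))
    (hclosed : IsClosed (H : Set (TwoStep.L2N v)))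
    (hinv : TwoStep.IsLeftInvariant v H)
    (hband : TwoStep.IsBandlimited v H)
    (hmf : TwoStep.IsMultiplicityFree v H) :
    ∃ Γ : Set (TwoStep.Grp v), TwoStep.IsQuasiLattice Γ ∧
      ∃ f ∈ H, TwoStep.IsParsevalFrame H (fun γ : Γ => TwoStep.leftReg v (γ : TwoStep.Grp v) f) := by
  open TwoStep in
  obtain ⟨U, hU⟩ := exists_plancherel hv
  obtain ⟨I, hIm, hIb, hIS, hI⟩ := hband
  obtain ⟨S, u, hS, hSc, hu, hu1, hH⟩ := hmf
  obtain ⟨R, hR, hRI⟩ := exists_bound (v := v) hIb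
  have hSI : MeasurableSet (S ∩ I) := hS.inter hIm
  have hu1' : ∀ lam ∈ S ∩ I, eLpNorm (u lam) 2 volume = 1 := fun lam hl => hu1 lam hl.1
  -- The window is scaled so that `c²` is the reciprocal of the volume of the cube of side `2R`.
  set c : ℝ := Real.sqrt (((2 * R) ^ (k + d))⁻¹)
  have hc : (2 * R) ^ (k + d) * c ^ 2 = 1 := by
    rw [Real.sq_sqrt (by positivity)]
    exact mul_inv_cancel₀ (by positivity)
  have hL : MemLp (windowKernel c (S ∩ I) u) 2 ((plancherelMeasure v).prod volume) :=
    memLp_windowKernel c hSI (plancherelMeasure_ne_top (hIb.subset Set.inter_subset_right)) hu hu1'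
  have ha : 0 < (2 * R)⁻¹ := by positivity
  have hf : U.symm (hL.toLp _) ∈ H :=
    (hH _).2 ⟨hL.toLp _, (hU _ _).2 (U.apply_symm_apply _).symm,
      memFibered_windowKernel c Set.inter_subset_left hL⟩
  refine ⟨Set.range (latticePoint v (2 * R)⁻¹), isQuasiLattice_latticePoint ha,
    U.symm (hL.toLp _), hf, fun γ => hinv _ _ hf, fun ψ hψ => ?_⟩
  have hK : MemFibered v (S ∩ I) u (U ψ) := by
    obtain ⟨K, hK, hKS⟩ := (hH ψ).1 hψ
    obtain ⟨K', hK', hKI⟩ := hI ψ hψ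
    rw [(hU _ _).1 hK] at hKS
    rw [(hU _ _).1 hK'] at hKI
    exact hKS.inter hKI
  have hsum := hasSum_boxes (integrable_fiberCoeff hSI hu hu1' hK).1
  rw [(integrable_fiberCoeff hSI hu hu1' hK).2, U.norm_map] at hsum
  have h1 := hasSum_prod_of_nonneg (f := fun j =>
    ‖inner ℂ (actDirect v (latticePoint v (2 * R)⁻¹ j) (hL.toLp _)) (U ψ)‖ ^ 2)
    (fun j => by positivity)
    (fun x => hasSum_latticePoint hv hR hc hSI (fun lam hl => hSc hl.1)
      (fun lam hl => hRI lam hl.2) hu hu1' hL hK x) hsum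
  -- Distinct indices give distinct points, so summing over the set `Γ` is summing over the indices.
  rw [← (Equiv.ofInjective _ (latticePoint_injective (v := v) ha)).hasSum_iff]
  refine hasSum_of_eq h1 fun j => ?_
  simp only [Function.comp_apply, Equiv.ofInjective_apply]
  rw [← U.inner_map_map, plancherel_leftReg hv hU, U.apply_symm_apply]
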